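/- **Setting.** Let $(I,\mathbb A,m)$ be a measure space with $m(I)<\infty$; write $|Q|=m(Q)$. Let $0<c_1<c_2<1$ and let $\mathcal P=(\mathcal P^k)_{k\ge 0}$ be a $(c_1,c_2)$-good grid: each $\mathcal P^k$ is a finite family of measurable sets of positive measure, no set belongs to two different levels, $C_{\mathcal P}=\sup_k\sup_{Q\in\mathcal P^k}\#\{P\in\mathcal P^k: P\cap Q\neq\emptyset\}<\infty$, and - $\mathcal P^0=\{I\}$; for every $k$ the sets of $\mathcal P^k$ are pairwise disjoint and cover $I$ up to a null set; - every $Q\in\mathcal P^{k+1}$ is contained in some $P\in\mathcal P^{k}$, and $c_1\le |Q|/|P|\le c_2$ whenever $Q\in\mathcal P^{k+1}$, $P\in\mathcal P^k$, $Q\subset P$; - $\bigcup_k\mathcal P^k$ generates $\mathbb A$. Put $|\mathcal P^k|=\max_{Q\in\mathcal P^k}|Q|$. Let $p\in[1,\infty)$, $q\in[1,\infty]$, $0<s<1/p$. An $(s,p)$-Souza atom on $Q$ is a function $a\colon I\to\mathbb C$ that vanishes off $Q$, is constant on $Q$, and satisfies $|a|_\infty\le |Q|^{s-1/p}$. The space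 $\mathcal B^s_{p,q}$ consists of all complex functions $g\in L^p$ (modulo a.e. equality) that have a representation $$g=\sum_{k\ge0}\sum_{Q\in\mathcal P^k}c_Q a_Q,\qquad c_Q\in\mathbb C,\ a_Q \text{ an } (s,p)\text{-Souza atom on } Q,$$ converging absolutely in $L^p$, that is, $\sum_k\big|\sum_{Q\in\mathcal P^k}c_Qa_Q\big|_p<\infty$, with finite cost $$\Big(\sum_k\Big(\sum_{Q\in\mathcal P^k}|c_Q|^p\Big)^{q/p}\Big)^{1/q}$$ (a supremum over $k$ if $q=\infty$); $|g|_{\mathcal B^s_{p,q}}$ is the infimum of the costs of all such representations of $g$. **Constants.** With $1/q+1/q'=1$ let $$C_2=\frac{c_2^{1/2}}{\sqrt2\,c_1^{3/2}}+1,\qquad C_e=1+C_2\max\{c_2^{1/p-s},c_1^{1/p-s}\}\,c_1^{-2-1/p},$$ $$C_{no}=C_{\mathcal P}^{1+1/p}\Big(\sum_k|\mathcal P^k|^{sq'}\Big)^{1/q'}|I|^{-s}+\frac1{1-c_2^s},$$ where $\big(\sum_k|\mathcal P^k|^{sq'}\big)^{1/q'}$ is read as $\sup_k|\mathcal P^k|^s$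 if $q=1$. **Proposition 17.1 (Pointwise multipliers III).** The constant $C_eC_{no}$ is finite. If $f,g\in\mathcal B^s_{p,q}\cap L^\infty$, then $fg\in\mathcal B^s_{p,q}\cap L^\infty$ and $$|fg|_{\mathcal B^s_{p,q}}+|fg|_\infty\le C_eC_{no}\,\big(|f|_{\mathcal B^s_{p,q}}+|f|_\infty\big)\big(|g|_{\mathcal B^s_{p,q}}+|g|_\infty\big).$$ Consequently $\mathcal B^s_{p,q}\cap L^\infty$ is a quasi-Banach algebra: it is a complex linear space closed under products, $|\cdot|_{\mathcal B^s_{p,q}}+|\cdot|_\infty$ is a complete norm on it, and the norm of a product is at most a finite constant times the product of the norms. -/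

import Mathlib

open MeasureTheory Filter Topology
open scoped ENNReal NNReal

namespace GridBesov

/-- The quantity `sup_k sup_{Q ∈ 𝓖^k} #{P ∈ 𝓖^k : P ∩ Q ≠ ∅}` of a sequence of finite families of
sets. -/
noncomputable def overlap {I : Type*} (F : ℕ → Finset (Set I)) : ℝ≥0∞ :=
  ⨆ (k : ℕ) (Q ∈ F k), (({P : Set I | P ∈ F k ∧ (P ∩ Q).Nonempty}.encard : ℕ∞) : ℝ≥0∞)

/-- A grid of the measure space `(I, m)`: a sequence of finite families of measurable sets with
positive measure, not all empty, with uniformly bounded overlap inside each level, and such that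
no set occurs in two different levels. -/
structure Grid {I : Type*} [MeasurableSpace I] (m : Measure I) where
  /-- The family of sets at level `k`. -/
  sets : ℕ → Finset (Set I)
  measurableSet : ∀ k, ∀ Q ∈ sets k, MeasurableSet Q
  measure_pos : ∀ k, ∀ Q ∈ sets k, 0 < m Q
  exists_nonempty : ∃ k, (sets k).Nonempty
  overlap_lt_top : overlap sets < ∞
  ne_of_level_ne : ∀ i j, i ≠ j → ∀ P ∈ sets i, ∀ Q ∈ sets j, P ≠ Q

/-- `(c₁, c₂)`-good grids. -/
structure Grid.IsGood {I : Type*} [mI : MeasurableSpace I] {m : Measure I} (𝓖 : Grid m)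
    (c₁ c₂ : ℝ) : Prop where
  pos : 0 < c₁
  lt : c₁ < c₂
  lt_one : c₂ < 1
  level_zero : 𝓖.sets 0 = {Set.univ}
  /-- Each level covers the space up to a null set. -/
  cover : ∀ k, m (⋃ Q ∈ 𝓖.sets k, Q)ᶜ = 0
  disjoint : ∀ k, ∀ P ∈ 𝓖.sets k, ∀ Q ∈ 𝓖.sets k, P ≠ Q → Disjoint P Q
  nested : ∀ k, ∀ Q ∈ 𝓖.sets (k + 1), ∃ P ∈ 𝓖.sets k, Q ⊆ P
  ratio : ∀ k, ∀ Q ∈ 𝓖.sets (k + 1), ∀ P ∈ 𝓖.sets k, Q ⊆ P →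
    c₁ ≤ m.real Q / m.real P ∧ m.real Q / m.real P ≤ c₂
  /-- The sets of the grid generate the σ-algebra of the space. -/
  generate : MeasurableSpace.generateFrom {Q : Set I | ∃ k, Q ∈ 𝓖.sets k} = mI

/-- `|𝓖^k|`, the largest measure of a set of level `k`. -/
noncomputable def Grid.mesh {I : Type*} [MeasurableSpace I] {m : Measure I} (𝓖 : Grid m)
    (k : ℕ) : ℝ≥0∞ :=
  ⨆ Q ∈ 𝓖.sets k, m Q

/-- The `(s,p)`-Souza atoms supported on `Q`: functions vanishing off `Q` and constant on `Q`, with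
`|a|_∞ ≤ |Q|^{s - 1/p}`. -/
def souzaAtoms {I : Type*} [MeasurableSpace I] (m : Measure I) (s p : ℝ) (Q : Set I) :
    Set (I → ℂ) :=
  {a | (∀ x, x ∉ Q → a x = 0) ∧ (∃ z : ℂ, ∀ x ∈ Q, a x = z) ∧
    eLpNorm a ∞ m ≤ m Q ^ (s - 1 / p)}

/-- The cost `(∑_k (∑_{Q ∈ 𝓖^k} |c_Q|^p)^{q/p})^{1/q}`, a supremum over `k` if `q = ∞`. -/
noncomputable def Grid.cost {I : Type*} [MeasurableSpace I] {m : Measure I} (𝓖 : Grid m)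
    (p : ℝ) (q : ℝ≥0∞) (c : Set I → ℂ) : ℝ≥0∞ :=
  if q = ∞ then ⨆ k : ℕ, (∑ Q ∈ 𝓖.sets k, ‖c Q‖ₑ ^ p) ^ (1 / p)
  else (∑' k : ℕ, (∑ Q ∈ 𝓖.sets k, ‖c Q‖ₑ ^ p) ^ (q.toReal / p)) ^ (1 / q.toReal)

/-- `g = ∑_k ∑_{Q ∈ 𝓖^k} c_Q a_Q` is a representation of `g ∈ L^p` by the atoms `𝒜`: the `a_Q` are
atoms, the cost is finite, and the series converges absolutely in `L^p`, with sum `g`.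
Coefficients and atoms are indexed by sets; only their values on the sets of the grid matter. -/
structure Grid.IsRep {I : Type*} [MeasurableSpace I] {m : Measure I} (𝓖 : Grid m)
    (𝒜 : Set I → Set (I → ℂ)) (p : ℝ) (q : ℝ≥0∞) (g : I →ₘ[m] ℂ)
    (c : Set I → ℂ) (a : Set I → I → ℂ) : Prop where
  memLp : MemLp g (ENNReal.ofReal p) m
  atom : ∀ k, ∀ Q ∈ 𝓖.sets k, a Q ∈ 𝒜 Q
  cost_lt_top : 𝓖.cost p q c < ∞
  absConv : ∑' k : ℕ, eLpNorm (fun x => ∑ Q ∈ 𝓖.sets k, c Q * a Q x) (ENNReal.ofReal p) m ^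
    (p / max p 1) < ∞
  tendsto : Tendsto (fun n : ℕ => eLpNorm
    (fun x => g x - ∑ k ∈ Finset.range n, ∑ Q ∈ 𝓖.sets k, c Q * a Q x) (ENNReal.ofReal p) m)
    atTop (𝓝 0)

/-- The space `𝓑^s_{p,q}` of the grid, built on Souza atoms; functions are identified when they
agree almost everywhere. -/
def Grid.besov {I : Type*} [MeasurableSpace I] {m : Measure I} (𝓖 : Grid m)
    (s p : ℝ) (q : ℝ≥0∞) : Set (I →ₘ[m] ℂ) :=
  {g | ∃ c a, 𝓖.IsRep (souzaAtoms m s p) p q g c a}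

/-- The norm of `𝓑^s_{p,q}`: the infimum of the costs of all representations (`∞` if there is
none). -/
noncomputable def Grid.besovNorm {I : Type*} [MeasurableSpace I] {m : Measure I} (𝓖 : Grid m)
    (s p : ℝ) (q : ℝ≥0∞) (g : I →ₘ[m] ℂ) : ℝ≥0∞ :=
  ⨅ (c : Set I → ℂ) (a : Set I → I → ℂ) (_ : 𝓖.IsRep (souzaAtoms m s p) p q g c a), 𝓖.cost p q c

/-- The space `𝓑^s_{p,q} ∩ L^∞`. -/
def Grid.besovLinfty {I : Type*} [MeasurableSpace I] {m : Measure I} (𝓖 : Grid m)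
    (s p : ℝ) (q : ℝ≥0∞) : Set (I →ₘ[m] ℂ) :=
  {g | g ∈ 𝓖.besov s p q ∧ MemLp g ∞ m}

/-- The norm `|g|_{𝓑^s_{p,q}} + |g|_∞`. -/
noncomputable def Grid.besovLinftyNorm {I : Type*} [MeasurableSpace I] {m : Measure I}
    (𝓖 : Grid m) (s p : ℝ) (q : ℝ≥0∞) (g : I →ₘ[m] ℂ) : ℝ≥0∞ :=
  𝓖.besovNorm s p q g + eLpNorm g ∞ m

/-- The set `S` of (classes of) measurable functions, with the functional `N` and the pointwise
operations, is a quasi-Banach algebra: it is a linear subspace closed under products, `N` is a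
complete norm on it, and `N (f * g) ≤ C * N f * N g` for some finite constant `C` (which need not
be `1`). -/
structure IsQuasiBanachAlgebra {I : Type*} [MeasurableSpace I] {m : Measure I}
    (S : Set (I →ₘ[m] ℂ)) (N : (I →ₘ[m] ℂ) → ℝ≥0∞) : Prop where
  zero_mem : (0 : I →ₘ[m] ℂ) ∈ S
  add_mem : ∀ f ∈ S, ∀ g ∈ S, f + g ∈ S
  smul_mem : ∀ (z : ℂ), ∀ f ∈ S, z • f ∈ S
  mul_mem : ∀ f ∈ S, ∀ g ∈ S, f * g ∈ S
  lt_top : ∀ f ∈ S, N f < ∞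
  eq_zero_iff : ∀ f ∈ S, N f = 0 ↔ f = 0
  smul_eq : ∀ (z : ℂ), ∀ f ∈ S, N (z • f) = ‖z‖ₑ * N f
  add_le : ∀ f ∈ S, ∀ g ∈ S, N (f + g) ≤ N f + N g
  mul_le : ∃ C : ℝ≥0, ∀ f ∈ S, ∀ g ∈ S, N (f * g) ≤ C * N f * N g
  complete : ∀ u : ℕ → (I →ₘ[m] ℂ), (∀ n, u n ∈ S) →
    (∀ ε : ℝ≥0∞, 0 < ε → ∃ n₀, ∀ i ≥ n₀, ∀ j ≥ n₀, N (u i - u j) < ε) →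
    ∃ f ∈ S, Tendsto (fun n => N (u n - f)) atTop (𝓝 0)

/-- The Hölder constant of the sequence `b`, for `t, q ≥ 1`: `(∑_k b_k^{q'/t})^{1/q'}` with
`1/q + 1/q' = 1` if `q > 1` (so `q' = 1` if `q = ∞`), and `sup_k b_k^{1/t}` if `q = 1`. -/
noncomputable def holderConst (t : ℝ) (q : ℝ≥0∞) (b : ℕ → ℝ≥0∞) : ℝ≥0∞ :=
  if q = 1 then ⨆ k, b k ^ (1 / t)
  else (∑' k, b k ^ ((ENNReal.conjExponent q).toReal / t)) ^ (1 / (ENNReal.conjExponent q).toReal)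

/-- `c₂^{1/2} / (√2 c₁^{3/2}) + 1`, the bound of the Haar functions of a `(c₁, c₂)`-good grid. -/
noncomputable def haarConst (c₁ c₂ : ℝ) : ℝ :=
  c₂ ^ (1 / 2 : ℝ) / (√2 * c₁ ^ (3 / 2 : ℝ)) + 1

/-- `1 + C max {c₂^{1/p-s}, c₁^{1/p-s}} c₁^{-2-1/p}` with `C` the constant of the Haar functions:
it compares the Haar coefficients of a function with its standard atomic representation. -/
noncomputable def stdConst (c₁ c₂ s p : ℝ) : ℝ :=
  1 + haarConst c₁ c₂ * max (c₂ ^ (1 / p - s)) (c₁ ^ (1 / p - s)) * c₁ ^ (-2 - 1 / p)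

/-- The constant that compares the mean oscillation of a function with its Besov norm. -/
noncomputable def Grid.oscConst {I : Type*} [MeasurableSpace I] {m : Measure I} (𝓖 : Grid m)
    (c₂ s p : ℝ) (q : ℝ≥0∞) : ℝ≥0∞ :=
  overlap 𝓖.sets ^ (1 + 1 / p) * holderConst p q (fun k => 𝓖.mesh k ^ (s * p)) *
      m Set.univ ^ (-s) +
    ENNReal.ofReal (1 / (1 - c₂ ^ s))

end GridBesov

/-!
On a good grid a finite sum of atoms of level `k` is a step function, and the sum of the first
`n + 1` levels of a representation of `g` is measurable at level `n`. Conversely the increments of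
a sequence of such functions converging to `g` are sums of atoms, so the Besov norm is the infimum,
over the adapted approximations `F` of `g`, of the `ℓ^q(L^p)` norms of `|Q|^{-s} (F_k - F_{k-1})`.

The martingale `E_k g` is optimal up to a constant. Since `F_{k-1}` is measurable at the levels
`k - 1` and `k`, the increment `E_k g - E_{k-1} g` does not change when `g` is replaced by
`g - F_{k-1} = ∑_{j ≥ k} (F_j - F_{j-1})`; conditional expectations are contractions of the
weighted `L^p` spaces, and the weights `|Q|^{-s}` grow geometrically with the level, so that a
discrete Hardy inequality bounds the norm of the martingale by that of `F`.

As `E_k` is also a contraction of `L^∞`, the Leibniz rule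
`F_k G_k - F_{k-1} G_{k-1} = (F_k - F_{k-1}) G_k + F_{k-1} (G_k - G_{k-1})` for `F_k = E_k f` and
`G_k = E_k g` estimates the norm of `f g`. Completeness holds because the norm of the martingale is
lower semicontinuous for convergence in `L^p`. The constant of the argument is
`(1 + c₁^{-s} c₂^s) / (1 - c₂^s)`, and it is dominated by `C_e C_no`.
-/

namespace GridBesov

section SequenceNorms

variable {α : Type*} [MeasurableSpace α] {μ : Measure α} {q C : ℝ≥0∞}

theorem eLpNorm_ennreal_le_of_ae_tendsto {f : ℕ → α → ℝ≥0∞} {g : α → ℝ≥0∞}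
    (hf : ∀ n, AEMeasurable (f n) μ) (h : ∀ᵐ x ∂μ, Tendsto (fun n => f n x) atTop (𝓝 (g x)))
    (hC : ∀ᶠ n in atTop, eLpNorm (f n) q μ ≤ C) : eLpNorm g q μ ≤ C := by
  rcases eq_or_ne q 0 with rfl | hq0
  · simp
  rcases eq_or_ne q ∞ with rfl | hq
  · obtain ⟨N, hN⟩ := eventually_atTop.1 hC
    have hle : ∀ᵐ x ∂μ, ∀ n ≥ N, f n x ≤ C := by
      refine ae_all_iff.2 fun n => ?_
      by_cases hn : N ≤ n
      · filter_upwards [ae_le_eLpNormEssSup (f := f n) (μ := μ)] with x hx _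
        exact hx.trans (hN n hn)
      · exact Eventually.of_forall fun x hx => absurd hx hn
    refine essSup_le_of_ae_le C ?_
    filter_upwards [h, hle] with x hx hxC
    exact le_of_tendsto hx (eventually_atTop.2 ⟨N, hxC⟩)
  have hq' : 0 < q.toReal := ENNReal.toReal_pos hq0 hq
  rw [eLpNorm_eq_lintegral_rpow_enorm_toReal hq0 hq, one_div, ENNReal.rpow_inv_le_iff hq']
  calc ∫⁻ x, ‖g x‖ₑ ^ q.toReal ∂μ
      = ∫⁻ x, liminf (fun n => f n x ^ q.toReal) atTop ∂μ := by
        refine lintegral_congr_ae ?_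
        filter_upwards [h] with x hx
        exact ((hx.ennrpow_const q.toReal).liminf_eq).symm
    _ ≤ liminf (fun n => ∫⁻ x, f n x ^ q.toReal ∂μ) atTop :=
        lintegral_liminf_le' fun n => (hf n).pow_const _
    _ ≤ C ^ q.toReal := by
        refine liminf_le_of_frequently_le' (hC.mono fun n hn => ?_).frequently
        rwa [eLpNorm_eq_lintegral_rpow_enorm_toReal hq0 hq, one_div,
          ENNReal.rpow_inv_le_iff hq'] at hn

theorem eLpNorm_tsum_le {f : ℕ → α → ℝ≥0∞} (hf : ∀ i, AEMeasurable (f i) μ) (hq : 1 ≤ q) :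
    eLpNorm (fun x => ∑' i, f i x) q μ ≤ ∑' i, eLpNorm (f i) q μ := by
  refine eLpNorm_ennreal_le_of_ae_tendsto (f := fun n => ∑ i ∈ Finset.range n, f i)
    (fun n => Finset.aemeasurable_sum _ fun i _ => hf i) (Eventually.of_forall fun x => ?_)
    (Eventually.of_forall fun n => ?_)
  · simpa only [Finset.sum_apply] using ENNReal.summable.hasSum.tendsto_sum_nat
  · exact (eLpNorm_sum_le (fun i _ => (hf i).aestronglyMeasurable) hq).trans
      (ENNReal.sum_le_tsum _)

theorem eLpNorm_count_comp_le {ι κ : Type*} [MeasurableSpace ι] [DiscreteMeasurableSpace ι]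
    [MeasurableSpace κ] [DiscreteMeasurableSpace κ] (a : κ → ℝ≥0∞) {φ : ι → κ}
    (hφ : φ.Injective) :
    eLpNorm (a ∘ φ) q Measure.count ≤ eLpNorm a q Measure.count := by
  have hmap : Measure.map φ Measure.count ≤ (Measure.count : Measure κ) := by
    refine Measure.le_iff.2 fun t ht => ?_
    rw [Measure.map_apply (Measurable.of_discrete) ht, Measure.count_apply .of_discrete,
      Measure.count_apply ht]
    exact_mod_cast Set.encard_le_encard_of_injOn (Set.mapsTo_preimage φ t) hφ.injOn
  rw [← eLpNorm_map_measure Measurable.of_discrete.aestronglyMeasurable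
    Measurable.of_discrete.aemeasurable]
  exact eLpNorm_mono_measure a hmap

theorem eLpNorm_count_const_mul_le (c : ℝ≥0∞) (a : ℕ → ℝ≥0∞) :
    eLpNorm (fun k => c * a k) q Measure.count ≤ c * eLpNorm a q Measure.count :=
  eLpNorm_le_mul_eLpNorm_of_ae_le_mul'' q Measurable.of_discrete.aestronglyMeasurable
    (Eventually.of_forall fun _ => le_rfl)

theorem eLpNorm_count_geometric_tail_le (hq : 1 ≤ q) (r : ℝ≥0∞) (a : ℕ → ℝ≥0∞) :
    eLpNorm (fun k => ∑' i, r ^ i * a (k + i)) q Measure.count ≤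
      (1 - r)⁻¹ * eLpNorm a q Measure.count := by
  calc eLpNorm (fun k => ∑' i, r ^ i * a (k + i)) q Measure.count
      ≤ ∑' i, eLpNorm (fun k => r ^ i * a (k + i)) q Measure.count :=
        eLpNorm_tsum_le (fun i => Measurable.of_discrete.aemeasurable) hq
    _ ≤ ∑' i, r ^ i * eLpNorm a q Measure.count := by
        refine ENNReal.tsum_le_tsum fun i => ?_
        exact (eLpNorm_count_const_mul_le _ _).trans
          (mul_le_mul_right (eLpNorm_count_comp_le a (add_left_injective i)) _)
    _ = (1 - r)⁻¹ * eLpNorm a q Measure.count := by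
        rw [ENNReal.tsum_mul_right, ENNReal.tsum_geometric]

end SequenceNorms

section LpConvergence

variable {α E : Type*} [MeasurableSpace α] {μ : Measure α} [NormedAddCommGroup E] {p : ℝ≥0∞}

theorem tendsto_eLpNorm_of_tendsto_eLpNorm_sub (hp : 1 ≤ p) {v : ℕ → α → E} {u : α → E}
    (hv : ∀ n, MemLp (v n) p μ) (hu : MemLp u p μ)
    (hlim : Tendsto (fun n => eLpNorm (v n - u) p μ) atTop (𝓝 0)) :
    Tendsto (fun n => eLpNorm (v n) p μ) atTop (𝓝 (eLpNorm u p μ)) := by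
  have : Fact (1 ≤ p) := ⟨hp⟩
  simpa only [Lp.enorm_toLp] using ((Lp.tendsto_Lp_iff_tendsto_eLpNorm'' v hv u hu).2 hlim).enorm

theorem exists_tendsto_eLpNorm_sub [CompleteSpace E] (hp : 1 ≤ p) {u : ℕ → α →ₘ[μ] E}
    (hu : ∀ n, MemLp (u n) p μ)
    (hcauchy : ∀ ε : ℝ≥0∞, 0 < ε → ∃ N, ∀ i ≥ N, ∀ j ≥ N,
      eLpNorm (u i - u j : α →ₘ[μ] E) p μ < ε) :
    ∃ f : α →ₘ[μ] E, MemLp f p μ ∧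
      Tendsto (fun n => eLpNorm (u n - f : α →ₘ[μ] E) p μ) atTop (𝓝 0) := by
  have : Fact (1 ≤ p) := ⟨hp⟩
  let U (n : ℕ) : Lp E p μ := ⟨u n, Lp.mem_Lp_iff_memLp.2 (hu n)⟩
  have hedist (f g : Lp E p μ) : edist f g = eLpNorm (f.1 - g.1 : α →ₘ[μ] E) p μ := by
    rw [Lp.edist_def, ← eLpNorm_congr_ae (AEEqFun.coeFn_sub f.1 g.1)]
  have hU : CauchySeq U := by
    rw [EMetric.cauchySeq_iff]
    simpa only [hedist] using hcauchy
  obtain ⟨f, hf⟩ := cauchySeq_tendsto_of_complete hU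
  refine ⟨f, Lp.memLp f, ?_⟩
  simpa only [hedist] using tendsto_iff_edist_tendsto_0.1 hf

theorem tendsto_eLpNorm_of_tendsto_eLpNorm_top [IsFiniteMeasure μ] {v : ℕ → α → E}
    (hv : ∀ n, AEStronglyMeasurable (v n) μ)
    (hlim : Tendsto (fun n => eLpNorm (v n) ∞ μ) atTop (𝓝 0)) :
    Tendsto (fun n => eLpNorm (v n) p μ) atTop (𝓝 0) := by
  have hfactor : μ Set.univ ^ (1 / p.toReal - 1 / (∞ : ℝ≥0∞).toReal) ≠ ∞ :=
    ENNReal.rpow_ne_top_of_nonneg (by simp) (measure_ne_top μ _)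
  exact tendsto_of_tendsto_of_tendsto_of_le_of_le tendsto_const_nhds
    (by simpa using ENNReal.Tendsto.mul_const hlim (Or.inr hfactor)) (fun _ => zero_le)
    fun n => eLpNorm_le_eLpNorm_mul_rpow_measure_univ le_top (hv n)

end LpConvergence

section MartingaleApproximation

variable {Ω E : Type*} [mΩ : MeasurableSpace Ω] {μ : Measure Ω} [IsFiniteMeasure μ]
  [NormedAddCommGroup E] {ℱ : Filtration ℕ mΩ} {p : ℝ≥0∞} {f : Ω → E}

theorem measureDense_filtration (hℱ : ⨆ n, ℱ n = mΩ) :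
    μ.MeasureDense {t | ∃ n, MeasurableSet[ℱ n] t} := by
  refine Measure.MeasureDense.of_generateFrom_isSetAlgebra_finite μ
    { empty_mem := ⟨0, @MeasurableSet.empty Ω (ℱ 0)⟩
      compl_mem := fun t ⟨n, ht⟩ => ⟨n, ht.compl⟩
      union_mem := fun t t' ⟨n, ht⟩ ⟨n', ht'⟩ => ⟨max n n',
        (ℱ.mono (le_max_left n n') _ ht).union (ℱ.mono (le_max_right n n') _ ht')⟩ }
    (hℱ.symm.trans (MeasurableSpace.measurableSpace_iSup_eq _))

theorem exists_memLp_eLpNorm_sub_le (hℱ : ⨆ n, ℱ n = mΩ) (hp : p ≠ ∞)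
    (hf : MemLp f p μ) {ε : ℝ≥0∞} (hε : ε ≠ 0) :
    ∃ g : Ω → E, eLpNorm (f - g) p μ ≤ ε ∧ MemLp g p μ ∧ ∃ n, StronglyMeasurable[ℱ n] g := by
  refine hf.induction_dense hp (fun g => MemLp g p μ ∧ ∃ n, StronglyMeasurable[ℱ n] g) ?_ ?_ ?_ hε
  · intro c s hs _ ε hε
    obtain ⟨η, hη, hη_le⟩ := exists_eLpNorm_indicator_le (μ := μ) hp c hε
    obtain ⟨t, ⟨n, ht⟩, hst⟩ := (measureDense_filtration hℱ).approx s hs (measure_ne_top μ s) η hη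
    refine ⟨t.indicator fun _ => c, ?_, ?_, n, stronglyMeasurable_const.indicator ht⟩
    case' refine_2 => exact (memLp_const c).indicator (ℱ.le n _ ht)
    rw [eLpNorm_sub_comm]
    refine le_trans (eLpNorm_mono_enorm fun x => ?_) (hη_le (symmDiff s t) ?_)
    · by_cases hxs : x ∈ s <;> by_cases hxt : x ∈ t <;> simp [hxs, hxt, Set.mem_symmDiff]
    · exact hst.le.trans (by simp)
  · rintro g g' ⟨hgp, n, hg⟩ ⟨hgp', n', hg'⟩
    exact ⟨hgp.add hgp', max n n', (hg.mono (ℱ.mono (le_max_left n n'))).add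
      (hg'.mono (ℱ.mono (le_max_right n n')))⟩
  · exact fun g hg => hg.1.1

theorem tendsto_eLpNorm_sub_condExp [NormedSpace ℝ E] [CompleteSpace E]
    (hℱ : ⨆ n, ℱ n = mΩ) (hp : 1 ≤ p) (hp_top : p ≠ ∞) (hf : MemLp f p μ) :
    Tendsto (fun n => eLpNorm (f - μ[f | ℱ n]) p μ) atTop (𝓝 0) := by
  refine ENNReal.tendsto_atTop_zero.2 fun ε hε => ?_
  obtain ⟨g, hfg, hgp, N, hg⟩ := exists_memLp_eLpNorm_sub_le hℱ hp_top hf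
    (ENNReal.half_pos hε.ne').ne'
  refine ⟨N, fun n hn => ?_⟩
  have hg_int : Integrable g μ := hgp.integrable hp
  have hcond : f - μ[f | ℱ n] =ᵐ[μ] (f - g) - μ[f - g | ℱ n] := by
    have hgn : μ[g | ℱ n] = g :=
      condExp_of_stronglyMeasurable (ℱ.le n) (hg.mono (ℱ.mono hn)) hg_int
    filter_upwards [condExp_sub (hf.integrable hp) hg_int (ℱ n)] with x hx
    simp only [Pi.sub_apply, hx, hgn]
    abel
  calc eLpNorm (f - μ[f | ℱ n]) p μ = eLpNorm ((f - g) - μ[f - g | ℱ n]) p μ :=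
        eLpNorm_congr_ae hcond
    _ ≤ eLpNorm (f - g) p μ + eLpNorm (μ[f - g | ℱ n]) p μ :=
        eLpNorm_sub_le (hf.1.sub hgp.1)
          (stronglyMeasurable_condExp.mono (ℱ.le n)).aestronglyMeasurable hp
    _ ≤ ε / 2 + ε / 2 := by
        gcongr
        exact (eLpNorm_condExp_le_eLpNorm _ hp).trans hfg
    _ = ε := ENNReal.add_halves ε

end MartingaleApproximation

section Increments

variable {G : Type*}

/-- The sequence `F` delayed by one step, starting from `0`. -/
def previous [Zero G] (F : ℕ → G) : ℕ → G
  | 0 => 0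
  | k + 1 => F k

/-- The increments `F k - F (k - 1)` of the sequence `F`, with the convention `F (-1) = 0`. -/
def increment [Zero G] [Sub G] (F : ℕ → G) (k : ℕ) : G :=
  F k - previous F k

theorem sum_range_increment [AddCommGroup G] (F : ℕ → G) (k n : ℕ) :
    ∑ i ∈ Finset.range n, increment F (k + i) = previous F (k + n) - previous F k :=
  Finset.sum_range_sub (fun i => previous F (k + i)) n

theorem increment_partialSum [AddCommGroup G] (d : ℕ → G) (k : ℕ) :
    increment (fun n => ∑ j ∈ Finset.range (n + 1), d j) k = d k := by
  cases k <;> simp [increment, previous, Finset.sum_range_succ]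

theorem increment_add [AddCommGroup G] (F F' : ℕ → G) (k : ℕ) :
    increment (F + F') k = increment F k + increment F' k := by
  cases k <;> simp only [increment, previous, Pi.add_apply] <;> abel

theorem increment_smul {𝕜 : Type*} [AddCommGroup G] [Monoid 𝕜] [DistribMulAction 𝕜 G] (z : 𝕜)
    (F : ℕ → G) (k : ℕ) : increment (z • F) k = z • increment F k := by
  cases k <;> simp only [increment, previous, Pi.smul_apply, smul_sub, smul_zero]

theorem increment_mul [NonUnitalRing G] (F F' : ℕ → G) (k : ℕ) :
    increment (F * F') k = increment F k * F' k + previous F k * increment F' k := by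
  cases k <;> simp only [increment, previous, Pi.mul_apply] <;> noncomm_ring

end Increments

section Variation

variable {Ω E : Type*} [mΩ : MeasurableSpace Ω] {μ : Measure Ω} [NormedAddCommGroup E]
  {w : ℕ → Ω → ℝ} {p q : ℝ≥0∞} {F F' : ℕ → Ω → E}

theorem aestronglyMeasurable_increment (hF : ∀ k, AEStronglyMeasurable (F k) μ) (k : ℕ) :
    AEStronglyMeasurable (increment F k) μ := by
  cases k with
  | zero => exact (hF 0).sub aestronglyMeasurable_zero
  | succ k => exact (hF (k + 1)).sub (hF k)

theorem memLp_previous (hF : ∀ k, MemLp (F k) p μ) (k : ℕ) : MemLp (previous F k) p μ := by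
  cases k with
  | zero => exact MemLp.zero
  | succ k => exact hF k

theorem memLp_increment (hF : ∀ k, MemLp (F k) p μ) (k : ℕ) : MemLp (increment F k) p μ :=
  (hF k).sub (memLp_previous hF k)

theorem stronglyAdapted_increment {ℱ : Filtration ℕ mΩ} (hF : StronglyAdapted ℱ F) :
    StronglyAdapted ℱ (increment F) := by
  rintro (_ | k)
  · exact (hF 0).sub stronglyMeasurable_zero
  · exact (hF (k + 1)).sub ((hF k).mono (ℱ.mono k.le_succ))

variable [NormedSpace ℝ E]

/-- The mixed `ℓ^q(L^p)` norm of the weighted increments of the sequence of functions `F`. -/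
noncomputable def variation (μ : Measure Ω) (w : ℕ → Ω → ℝ) (p q : ℝ≥0∞) (F : ℕ → Ω → E) :
    ℝ≥0∞ :=
  eLpNorm (fun k => eLpNorm (w k • increment F k) p μ) q Measure.count

theorem variation_zero : variation μ w p q (0 : ℕ → Ω → E) = 0 := by
  have h (k : ℕ) : w k • increment (0 : ℕ → Ω → E) k = 0 := by
    cases k <;> simp [increment, previous]
  simp only [variation, h, eLpNorm_zero]
  exact eLpNorm_zero'

theorem variation_const_smul_le {𝕜 : Type*} [NormedField 𝕜] [NormedSpace 𝕜 E]
    [SMulCommClass ℝ 𝕜 E] (z : 𝕜) (F : ℕ → Ω → E) :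
    variation μ w p q (z • F) ≤ ‖z‖ₑ * variation μ w p q F := by
  have hterm (k : ℕ) : eLpNorm (w k • increment (z • F) k) p μ =
      ‖z‖ₑ * eLpNorm (w k • increment F k) p μ := by
    have hcomm : w k • increment (z • F) k = z • (w k • increment F k) := by
      ext x
      simp only [increment_smul, Pi.smul_apply, Pi.smul_apply', smul_comm]
    rw [hcomm, eLpNorm_const_smul]
  simp only [variation, hterm]
  exact eLpNorm_count_const_mul_le _ _

theorem variation_add_le (hp : 1 ≤ p) (hq : 1 ≤ q) (hw : ∀ k, AEStronglyMeasurable (w k) μ)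
    (hF : ∀ k, AEStronglyMeasurable (F k) μ) (hF' : ∀ k, AEStronglyMeasurable (F' k) μ) :
    variation μ w p q (F + F') ≤ variation μ w p q F + variation μ w p q F' := by
  refine (eLpNorm_mono_enorm fun k => ?_).trans (eLpNorm_add_le
    Measurable.of_discrete.aestronglyMeasurable Measurable.of_discrete.aestronglyMeasurable hq)
  simp only [increment_add, smul_add, enorm_eq_self]
  exact eLpNorm_add_le ((hw k).smul (aestronglyMeasurable_increment hF k))
    ((hw k).smul (aestronglyMeasurable_increment hF' k)) hp

theorem variation_mul_le {A : Type*} [NormedRing A] [NormedAlgebra ℝ A] {F F' : ℕ → Ω → A}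
    (hp : 1 ≤ p) (hq : 1 ≤ q) (hw : ∀ k, AEStronglyMeasurable (w k) μ)
    (hF : ∀ k, AEStronglyMeasurable (F k) μ) (hF' : ∀ k, AEStronglyMeasurable (F' k) μ)
    {B B' : ℝ≥0∞} (hB : ∀ k, eLpNorm (F k) ∞ μ ≤ B) (hB' : ∀ k, eLpNorm (F' k) ∞ μ ≤ B') :
    variation μ w p q (F * F') ≤ B' * variation μ w p q F + B * variation μ w p q F' := by
  have hprev (k : ℕ) : AEStronglyMeasurable (previous F k) μ ∧ eLpNorm (previous F k) ∞ μ ≤ B := by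
    cases k with
    | zero => exact ⟨aestronglyMeasurable_zero, by simp [previous]⟩
    | succ k => exact ⟨hF k, hB k⟩
  have hterm (k : ℕ) : eLpNorm (w k • increment (F * F') k) p μ ≤
      B' * eLpNorm (w k • increment F k) p μ + B * eLpNorm (w k • increment F' k) p μ := by
    have hdF := (hw k).smul (aestronglyMeasurable_increment hF k)
    have hdF' := (hw k).smul (aestronglyMeasurable_increment hF' k)
    have hsplit : w k • increment (F * F') k =
        (w k • increment F k) • F' k + previous F k • (w k • increment F' k) := by
      ext x
      simp [increment_mul, smul_add]
    rw [hsplit]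
    refine (eLpNorm_add_le (hdF.smul (hF' k)) ((hprev k).1.smul hdF') hp).trans ?_
    gcongr
    · rw [mul_comm]
      exact (eLpNorm_smul_le_eLpNorm_mul_eLpNorm_top p _ hdF).trans (by gcongr; exact hB' k)
    · exact (eLpNorm_smul_le_eLpNorm_top_mul_eLpNorm p hdF' _).trans (by gcongr; exact (hprev k).2)
  calc variation μ w p q (F * F')
      ≤ eLpNorm (fun k => B' * eLpNorm (w k • increment F k) p μ +
          B * eLpNorm (w k • increment F' k) p μ) q Measure.count := eLpNorm_mono_enorm hterm
    _ ≤ eLpNorm (fun k => B' * eLpNorm (w k • increment F k) p μ) q Measure.count +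
          eLpNorm (fun k => B * eLpNorm (w k • increment F' k) p μ) q Measure.count :=
        eLpNorm_add_le Measurable.of_discrete.aestronglyMeasurable
          Measurable.of_discrete.aestronglyMeasurable hq
    _ ≤ B' * variation μ w p q F + B * variation μ w p q F' :=
        add_le_add (eLpNorm_count_const_mul_le _ _) (eLpNorm_count_const_mul_le _ _)

end Variation

section ApproximationNorm

variable {Ω E : Type*} [mΩ : MeasurableSpace Ω] {μ : Measure Ω} [NormedAddCommGroup E]
  {ℱ : Filtration ℕ mΩ} {w : ℕ → Ω → ℝ} {p q : ℝ≥0∞} {F F' : ℕ → Ω → E} {u v : Ω → E}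

/-- The functions `F n` approximate `u` in `L^p`, each `F n` being measurable with respect to the
`n`-th σ-algebra of the filtration. -/
structure IsAdaptedApprox (ℱ : Filtration ℕ mΩ) (μ : Measure Ω) (p : ℝ≥0∞) (F : ℕ → Ω → E)
    (u : Ω → E) : Prop where
  adapted : StronglyAdapted ℱ F
  memLp : ∀ n, MemLp (F n) p μ
  memLp_limit : MemLp u p μ
  tendsto : Tendsto (fun n => eLpNorm (u - F n) p μ) atTop (𝓝 0)

theorem IsAdaptedApprox.aestronglyMeasurable (hF : IsAdaptedApprox ℱ μ p F u) (n : ℕ) :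
    AEStronglyMeasurable (F n) μ :=
  (hF.memLp n).1

theorem IsAdaptedApprox.congr_ae (huv : u =ᵐ[μ] v) (hF : IsAdaptedApprox ℱ μ p F u) :
    IsAdaptedApprox ℱ μ p F v where
  adapted := hF.adapted
  memLp := hF.memLp
  memLp_limit := hF.memLp_limit.ae_eq huv
  tendsto := hF.tendsto.congr fun _ => eLpNorm_congr_ae (huv.sub EventuallyEq.rfl)

theorem isAdaptedApprox_zero : IsAdaptedApprox ℱ μ p (0 : ℕ → Ω → E) 0 where
  adapted _ := stronglyMeasurable_zero
  memLp _ := MemLp.zero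
  memLp_limit := MemLp.zero
  tendsto := by simp

theorem IsAdaptedApprox.add (hp : 1 ≤ p) (hF : IsAdaptedApprox ℱ μ p F u)
    (hF' : IsAdaptedApprox ℱ μ p F' v) : IsAdaptedApprox ℱ μ p (F + F') (u + v) where
  adapted n := (hF.adapted n).add (hF'.adapted n)
  memLp n := (hF.memLp n).add (hF'.memLp n)
  memLp_limit := hF.memLp_limit.add hF'.memLp_limit
  tendsto := by
    refine tendsto_of_tendsto_of_tendsto_of_le_of_le tendsto_const_nhds
      (by simpa using hF.tendsto.add hF'.tendsto) (fun _ => zero_le) fun n => ?_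
    rw [Pi.add_apply, add_sub_add_comm]
    exact eLpNorm_add_le (hF.memLp_limit.1.sub (hF.aestronglyMeasurable n))
      (hF'.memLp_limit.1.sub (hF'.aestronglyMeasurable n)) hp

theorem IsAdaptedApprox.const_smul {𝕜 : Type*} [NormedField 𝕜] [NormedSpace 𝕜 E] (z : 𝕜)
    (hF : IsAdaptedApprox ℱ μ p F u) : IsAdaptedApprox ℱ μ p (z • F) (z • u) where
  adapted n := (hF.adapted n).const_smul z
  memLp n := (hF.memLp n).const_smul z
  memLp_limit := hF.memLp_limit.const_smul z
  tendsto := by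
    simp only [Pi.smul_apply, ← smul_sub, eLpNorm_const_smul]
    simpa using ENNReal.Tendsto.const_mul hF.tendsto (Or.inr enorm_ne_top)

theorem IsAdaptedApprox.mul {A : Type*} [NormedRing A] {F F' : ℕ → Ω → A} {u v : Ω → A}
    (hp : 1 ≤ p) (hF : IsAdaptedApprox ℱ μ p F u) (hF' : IsAdaptedApprox ℱ μ p F' v)
    {B : ℝ≥0∞} (hB_top : B ≠ ∞) (hB : ∀ n, eLpNorm (F n) ∞ μ ≤ B)
    (hF'_top : ∀ n, MemLp (F' n) ∞ μ) (hv : MemLp v ∞ μ) :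
    IsAdaptedApprox ℱ μ p (F * F') (u * v) where
  adapted n := (hF.adapted n).mul (hF'.adapted n)
  memLp n := (hF'_top n).mul (hF.memLp n)
  memLp_limit := hv.mul hF.memLp_limit
  tendsto := by
    have hlim : Tendsto (fun n => eLpNorm (u - F n) p μ * eLpNorm v ∞ μ +
        B * eLpNorm (v - F' n) p μ) atTop (𝓝 0) := by
      simpa using (ENNReal.Tendsto.mul_const hF.tendsto (Or.inr hv.2.ne)).add
        (ENNReal.Tendsto.const_mul hF'.tendsto (Or.inr hB_top))
    refine tendsto_of_tendsto_of_tendsto_of_le_of_le tendsto_const_nhds hlim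
      (fun _ => zero_le) fun n => ?_
    have hu := hF.memLp_limit.1.sub (hF.aestronglyMeasurable n)
    have hv' := hF'.memLp_limit.1.sub (hF'.aestronglyMeasurable n)
    have hsplit : u * v - (F * F') n = (u - F n) • v + F n • (v - F' n) := by
      simp only [Pi.mul_apply, smul_eq_mul]
      noncomm_ring
    rw [hsplit]
    refine (eLpNorm_add_le (hu.smul hv.1) ((hF.aestronglyMeasurable n).smul hv') hp).trans ?_
    gcongr
    · exact eLpNorm_smul_le_eLpNorm_mul_eLpNorm_top p v hu
    · exact (eLpNorm_smul_le_eLpNorm_top_mul_eLpNorm p hv' _).trans (by gcongr; exact hB n)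

variable [NormedSpace ℝ E]

/-- The approximation norm of `u`: the infimum of the variations of its adapted approximations. For
the filtration of a good grid and the weights `|Q|^{-s}` it is the Besov norm. -/
noncomputable def approxNorm (ℱ : Filtration ℕ mΩ) (μ : Measure Ω) (w : ℕ → Ω → ℝ) (p q : ℝ≥0∞)
    (u : Ω → E) : ℝ≥0∞ :=
  ⨅ (F : ℕ → Ω → E) (_ : IsAdaptedApprox ℱ μ p F u), variation μ w p q F

theorem IsAdaptedApprox.approxNorm_le (hF : IsAdaptedApprox ℱ μ p F u) :
    approxNorm ℱ μ w p q u ≤ variation μ w p q F :=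
  iInf₂_le F hF

theorem approxNorm_congr_ae (huv : u =ᵐ[μ] v) :
    approxNorm ℱ μ w p q u = approxNorm ℱ μ w p q v :=
  le_antisymm (le_iInf₂ fun _ hF => (hF.congr_ae huv.symm).approxNorm_le)
    (le_iInf₂ fun _ hF => (hF.congr_ae huv).approxNorm_le)

theorem approxNorm_zero : approxNorm ℱ μ w p q (0 : Ω → E) = 0 :=
  le_antisymm (isAdaptedApprox_zero.approxNorm_le.trans variation_zero.le) zero_le

theorem approxNorm_add_le (hp : 1 ≤ p) (hq : 1 ≤ q) (hw : ∀ k, AEStronglyMeasurable (w k) μ)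
    (u v : Ω → E) :
    approxNorm ℱ μ w p q (u + v) ≤ approxNorm ℱ μ w p q u + approxNorm ℱ μ w p q v := by
  refine ENNReal.le_iInf₂_add_iInf₂ fun F hF F' hF' => ?_
  exact (hF.add hp hF').approxNorm_le.trans
    (variation_add_le hp hq hw hF.aestronglyMeasurable hF'.aestronglyMeasurable)

theorem approxNorm_const_smul_le {𝕜 : Type*} [NormedField 𝕜] [NormedSpace 𝕜 E]
    [SMulCommClass ℝ 𝕜 E] (z : 𝕜) (u : Ω → E) :
    approxNorm ℱ μ w p q (z • u) ≤ ‖z‖ₑ * approxNorm ℱ μ w p q u := by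
  rcases eq_or_ne z 0 with rfl | hz
  · simp [approxNorm_zero]
  rw [approxNorm, approxNorm, ENNReal.mul_iInf_of_ne (enorm_ne_zero.2 hz) enorm_ne_top]
  refine le_iInf fun F => ?_
  rw [ENNReal.mul_iInf_of_ne (enorm_ne_zero.2 hz) enorm_ne_top]
  exact le_iInf fun hF => (hF.const_smul z).approxNorm_le.trans (variation_const_smul_le z F)

theorem approxNorm_const_smul {𝕜 : Type*} [NormedField 𝕜] [NormedSpace 𝕜 E]
    [SMulCommClass ℝ 𝕜 E] (z : 𝕜) (u : Ω → E) :
    approxNorm ℱ μ w p q (z • u) = ‖z‖ₑ * approxNorm ℱ μ w p q u := by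
  rcases eq_or_ne z 0 with rfl | hz
  · simp [approxNorm_zero]
  refine (approxNorm_const_smul_le z u).antisymm ?_
  have h := approxNorm_const_smul_le (ℱ := ℱ) (μ := μ) (w := w) (p := p) (q := q) z⁻¹ (z • u)
  rw [inv_smul_smul₀ hz, enorm_inv hz, mul_comm, ← div_eq_mul_inv] at h
  rw [mul_comm]
  exact ENNReal.mul_le_of_le_div h

end ApproximationNorm

section GeometricWeights

variable {Ω E : Type*} [mΩ : MeasurableSpace Ω] {μ : Measure Ω} [NormedAddCommGroup E]
  [NormedSpace ℝ E] {ℱ : Filtration ℕ mΩ} {w : ℕ → Ω → ℝ} {r R : ℝ≥0} {p q : ℝ≥0∞}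
  {F : ℕ → Ω → E} {f u : Ω → E}

/-- The adapted weights `w k` grow at least geometrically with ratio `r⁻¹ > 1` and at most
geometrically with ratio `R`. The model case is the weight equal to `|Q|^{-s}` on every set `Q` of
level `k` of a good grid. -/
structure IsGeometricWeight (ℱ : Filtration ℕ mΩ) (μ : Measure Ω) (r R : ℝ≥0)
    (w : ℕ → Ω → ℝ) : Prop where
  adapted : StronglyAdapted ℱ w
  memLp_top : ∀ k, MemLp (w k) ∞ μ
  le_succ : ∀ k, ∀ᵐ x ∂μ, ‖w k x‖ₑ ≤ r * ‖w (k + 1) x‖ₑ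
  succ_le : ∀ k, ∀ᵐ x ∂μ, ‖w (k + 1) x‖ₑ ≤ R * ‖w k x‖ₑ
  ratio_lt_one : r < 1

theorem eLpNorm_smul_le_of_weight_le {v v' : Ω → ℝ} {c : ℝ≥0}
    (h : ∀ᵐ x ∂μ, ‖v x‖ₑ ≤ c * ‖v' x‖ₑ) (f : Ω → E) :
    eLpNorm (v • f) p μ ≤ c * eLpNorm (v' • f) p μ := by
  refine eLpNorm_le_mul_eLpNorm_of_ae_le_mul' (h.mono fun x hx => ?_) p
  simp only [Pi.smul_apply', enorm_smul, ← mul_assoc]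
  gcongr

theorem eLpNorm_smul_condExp_le [IsFiniteMeasure μ] [CompleteSpace E] {v : Ω → ℝ}
    {m : MeasurableSpace Ω} (hp : 1 ≤ p) (hv : AEStronglyMeasurable[m] v μ) (hv_top : MemLp v ∞ μ)
    (hf : MemLp f p μ) : eLpNorm (v • μ[f | m]) p μ ≤ eLpNorm (v • f) p μ := by
  have hvf : Integrable (v • f) μ := (hf.smul hv_top).integrable hp
  rw [← eLpNorm_congr_ae (condExp_smul_of_aestronglyMeasurable_left hv hvf (hf.integrable hp))]
  exact eLpNorm_condExp_le_eLpNorm _ hp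

/-- The bound for the passage from adapted approximations to the martingale in the Hardy inequality
`IsGeometricWeight.variation_condExp_le`, for weights growing with ratios between `r⁻¹` and `R`. It
is `∞` when `1 ≤ r`. -/
noncomputable def hardyConst (r R : ℝ≥0) : ℝ≥0∞ :=
  (1 + R * r) * (1 - (r : ℝ≥0∞))⁻¹

theorem one_le_hardyConst (r R : ℝ≥0) : 1 ≤ hardyConst r R := by
  refine one_le_mul le_self_add ?_
  rw [ENNReal.one_le_inv]
  exact tsub_le_self

namespace IsGeometricWeight

theorem hardyConst_lt_top (hw : IsGeometricWeight ℱ μ r R w) : hardyConst r R < ∞ := by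
  have hr : (1 : ℝ≥0∞) - r ≠ 0 := (tsub_pos_of_lt (by exact_mod_cast hw.ratio_lt_one)).ne'
  exact ENNReal.mul_lt_top (by finiteness) (ENNReal.inv_lt_top.2 (pos_iff_ne_zero.2 hr))

theorem aestronglyMeasurable (hw : IsGeometricWeight ℱ μ r R w) (k : ℕ) :
    AEStronglyMeasurable (w k) μ :=
  (hw.memLp_top k).1

theorem le_pow (hw : IsGeometricWeight ℱ μ r R w) (k i : ℕ) :
    ∀ᵐ x ∂μ, ‖w k x‖ₑ ≤ (r ^ i : ℝ≥0) * ‖w (k + i) x‖ₑ := by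
  induction i with
  | zero => simp
  | succ i ih =>
    filter_upwards [ih, hw.le_succ (k + i)] with x hx hx'
    calc ‖w k x‖ₑ ≤ (r ^ i : ℝ≥0) * ‖w (k + i) x‖ₑ := hx
      _ ≤ (r ^ i : ℝ≥0) * (r * ‖w (k + i + 1) x‖ₑ) := by gcongr
      _ = (r ^ (i + 1) : ℝ≥0) * ‖w (k + (i + 1)) x‖ₑ := by
        rw [pow_succ, ENNReal.coe_mul, mul_assoc, add_assoc]

theorem eLpNorm_smul_increment_condExp_le [IsFiniteMeasure μ] [CompleteSpace E]
    (hw : IsGeometricWeight ℱ μ r R w) (hp : 1 ≤ p) (hf : MemLp f p μ) (k : ℕ) :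
    eLpNorm (w k • increment (fun n => μ[f | ℱ n]) k) p μ ≤
      (1 + R * r) * eLpNorm (w k • f) p μ := by
  have hcond (n : ℕ) : eLpNorm (w n • μ[f | ℱ n]) p μ ≤ eLpNorm (w n • f) p μ :=
    eLpNorm_smul_condExp_le hp (hw.adapted n).aestronglyMeasurable (hw.memLp_top n) hf
  have hmeas (j n : ℕ) : AEStronglyMeasurable (w j • μ[f | ℱ n]) μ :=
    (hw.aestronglyMeasurable j).smul
      (stronglyMeasurable_condExp.mono (ℱ.le n)).aestronglyMeasurable
  cases k with
  | zero =>
    rw [increment, previous, sub_zero]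
    exact (hcond 0).trans (le_mul_of_one_le_left' le_self_add)
  | succ k =>
    calc eLpNorm (w (k + 1) • (μ[f | ℱ (k + 1)] - μ[f | ℱ k])) p μ
        ≤ eLpNorm (w (k + 1) • μ[f | ℱ (k + 1)]) p μ + eLpNorm (w (k + 1) • μ[f | ℱ k]) p μ := by
          rw [smul_sub]
          exact eLpNorm_sub_le (hmeas _ _) (hmeas _ _) hp
      _ ≤ eLpNorm (w (k + 1) • f) p μ + R * (r * eLpNorm (w (k + 1) • f) p μ) := by
          gcongr
          · exact hcond (k + 1)
          · calc eLpNorm (w (k + 1) • μ[f | ℱ k]) p μ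
                ≤ R * eLpNorm (w k • μ[f | ℱ k]) p μ :=
                  eLpNorm_smul_le_of_weight_le (hw.succ_le k) _
              _ ≤ R * eLpNorm (w k • f) p μ := by gcongr; exact hcond k
              _ ≤ R * (r * eLpNorm (w (k + 1) • f) p μ) := by
                gcongr
                exact eLpNorm_smul_le_of_weight_le (hw.le_succ k) _
      _ = (1 + R * r) * eLpNorm (w (k + 1) • f) p μ := by ring

theorem tendsto_eLpNorm_smul (hw : IsGeometricWeight ℱ μ r R w) {g : ℕ → Ω → E}
    (hg : ∀ n, AEStronglyMeasurable (g n) μ) (k : ℕ)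
    (h : Tendsto (fun n => eLpNorm (g n) p μ) atTop (𝓝 0)) :
    Tendsto (fun n => eLpNorm (w k • g n) p μ) atTop (𝓝 0) :=
  tendsto_of_tendsto_of_tendsto_of_le_of_le tendsto_const_nhds
    (by simpa using ENNReal.Tendsto.const_mul h (Or.inr (hw.memLp_top k).2.ne))
    (fun _ => zero_le) fun n => eLpNorm_smul_le_eLpNorm_top_mul_eLpNorm p (hg n) (w k)

theorem eLpNorm_smul_sub_previous_le_add_sum (hw : IsGeometricWeight ℱ μ r R w) (hp : 1 ≤ p)
    (hF : ∀ n, AEStronglyMeasurable (F n) μ) (hu : AEStronglyMeasurable u μ) (k n : ℕ) :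
    eLpNorm (w k • (u - previous F k)) p μ ≤ eLpNorm (w k • (u - F (k + n))) p μ +
      ∑ i ∈ Finset.range (n + 1), (r : ℝ≥0∞) ^ i *
        eLpNorm (w (k + i) • increment F (k + i)) p μ := by
  have hsplit : w k • (u - previous F k) = w k • (u - F (k + n)) +
      ∑ i ∈ Finset.range (n + 1), w k • increment F (k + i) := by
    have hsum : ∑ i ∈ Finset.range (n + 1), increment F (k + i) = F (k + n) - previous F k :=
      sum_range_increment F k (n + 1)
    rw [← Finset.smul_sum, hsum, ← smul_add, sub_add_sub_cancel]
  have hmeas (i : ℕ) : AEStronglyMeasurable (w k • increment F (k + i)) μ :=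
    (hw.aestronglyMeasurable k).smul (aestronglyMeasurable_increment hF (k + i))
  have hterm (i : ℕ) : eLpNorm (w k • increment F (k + i)) p μ ≤
      (r : ℝ≥0∞) ^ i * eLpNorm (w (k + i) • increment F (k + i)) p μ := by
    rw [← ENNReal.coe_pow]
    exact eLpNorm_smul_le_of_weight_le (hw.le_pow k i) _
  rw [hsplit]
  refine (eLpNorm_add_le ((hw.aestronglyMeasurable k).smul (hu.sub (hF _)))
    (Finset.aestronglyMeasurable_sum _ fun i _ => hmeas i) hp).trans (add_le_add le_rfl ?_)
  exact (eLpNorm_sum_le (fun i _ => hmeas i) hp).trans (Finset.sum_le_sum fun i _ => hterm i)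

theorem eLpNorm_smul_sub_previous_le (hw : IsGeometricWeight ℱ μ r R w) (hp : 1 ≤ p)
    (hF : IsAdaptedApprox ℱ μ p F u) (k : ℕ) :
    eLpNorm (w k • (u - previous F k)) p μ ≤
      ∑' i, (r : ℝ≥0∞) ^ i * eLpNorm (w (k + i) • increment F (k + i)) p μ := by
  have hlim : Tendsto (fun n => eLpNorm (w k • (u - F (k + n))) p μ) atTop (𝓝 0) :=
    hw.tendsto_eLpNorm_smul
      (fun n => hF.memLp_limit.1.sub (hF.aestronglyMeasurable (k + n))) k
      (hF.tendsto.comp (tendsto_add_atTop_nat k) |>.congr fun n => by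
        rw [Function.comp_apply, add_comm])
  refine ge_of_tendsto' (by simpa using hlim.add_const _) fun n => ?_
  exact (hw.eLpNorm_smul_sub_previous_le_add_sum hp hF.aestronglyMeasurable hF.memLp_limit.1
    k n).trans (add_le_add le_rfl (ENNReal.sum_le_tsum _))

end IsGeometricWeight

end GeometricWeights

section MartingaleNorm

variable {Ω E : Type*} [mΩ : MeasurableSpace Ω] {μ : Measure Ω} [IsFiniteMeasure μ]
  [NormedAddCommGroup E] [NormedSpace ℝ E] [CompleteSpace E] {ℱ : Filtration ℕ mΩ}
  {w : ℕ → Ω → ℝ} {r R : ℝ≥0} {p q : ℝ≥0∞} {F : ℕ → Ω → E} {f u : Ω → E}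

theorem isAdaptedApprox_condExp (hℱ : ⨆ n, ℱ n = mΩ) (hp : 1 ≤ p) (hp_top : p ≠ ∞)
    (hf : MemLp f p μ) : IsAdaptedApprox ℱ μ p (fun n => μ[f | ℱ n]) f where
  adapted _ := stronglyMeasurable_condExp
  memLp _ := hf.condExp hp
  memLp_limit := hf
  tendsto := tendsto_eLpNorm_sub_condExp hℱ hp hp_top hf

theorem increment_condExp_sub_previous (hp : 1 ≤ p) (hF : IsAdaptedApprox ℱ μ p F u) (k : ℕ) :
    increment (fun n => μ[u - previous F k | ℱ n]) k =ᵐ[μ] increment (fun n => μ[u | ℱ n]) k := by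
  cases k with
  | zero => simp only [previous, sub_zero]; rfl
  | succ k =>
    have hcond (n : ℕ) (hn : k ≤ n) : μ[u - F k | ℱ n] =ᵐ[μ] μ[u | ℱ n] - F k := by
      have hint := (hF.memLp k).integrable hp
      have h := condExp_sub (hF.memLp_limit.integrable hp) hint (ℱ n)
      rwa [condExp_of_stronglyMeasurable (ℱ.le n) ((hF.adapted k).mono (ℱ.mono hn)) hint] at h
    filter_upwards [hcond (k + 1) k.le_succ, hcond k le_rfl] with x hx hx'
    simp only [increment, previous, Pi.sub_apply, hx, hx', sub_sub_sub_cancel_right]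

theorem increment_condExp_sub (hp : 1 ≤ p) (hf : MemLp f p μ) (hu : MemLp u p μ) (k : ℕ) :
    increment (fun j => μ[f - u | ℱ j]) k =ᵐ[μ]
      increment (fun j => μ[f | ℱ j]) k - increment (fun j => μ[u | ℱ j]) k := by
  have h (j : ℕ) := condExp_sub (hf.integrable hp) (hu.integrable hp) (ℱ j)
  cases k with
  | zero => filter_upwards [h 0] with x hx; simp [increment, previous, hx]
  | succ k =>
    filter_upwards [h (k + 1), h k] with x hx hx'
    simp only [increment, previous, Pi.sub_apply, hx, hx', sub_sub_sub_comm]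

namespace IsGeometricWeight

theorem variation_condExp_le (hw : IsGeometricWeight ℱ μ r R w) (hp : 1 ≤ p) (hq : 1 ≤ q)
    (hF : IsAdaptedApprox ℱ μ p F u) :
    variation μ w p q (fun n => μ[u | ℱ n]) ≤ hardyConst r R * variation μ w p q F := by
  have hterm (k : ℕ) : eLpNorm (w k • increment (fun n => μ[u | ℱ n]) k) p μ ≤ (1 + R * r) *
      ∑' i, (r : ℝ≥0∞) ^ i * eLpNorm (w (k + i) • increment F (k + i)) p μ :=
    calc eLpNorm (w k • increment (fun n => μ[u | ℱ n]) k) p μ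
        = eLpNorm (w k • increment (fun n => μ[u - previous F k | ℱ n]) k) p μ :=
          eLpNorm_congr_ae (EventuallyEq.rfl.smul (increment_condExp_sub_previous hp hF k).symm)
      _ ≤ (1 + R * r) * eLpNorm (w k • (u - previous F k)) p μ :=
          hw.eLpNorm_smul_increment_condExp_le hp
            (hF.memLp_limit.sub (memLp_previous hF.memLp k)) k
      _ ≤ _ := by
          gcongr
          exact hw.eLpNorm_smul_sub_previous_le hp hF k
  calc variation μ w p q (fun n => μ[u | ℱ n])
      ≤ (1 + R * r) * eLpNorm (fun k => ∑' i, (r : ℝ≥0∞) ^ i *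
          eLpNorm (w (k + i) • increment F (k + i)) p μ) q Measure.count :=
        (eLpNorm_mono_enorm hterm).trans (eLpNorm_count_const_mul_le _ _)
    _ ≤ (1 + R * r) * ((1 - (r : ℝ≥0∞))⁻¹ * variation μ w p q F) := by
        gcongr
        exact eLpNorm_count_geometric_tail_le hq r fun k => eLpNorm (w k • increment F k) p μ
    _ = hardyConst r R * variation μ w p q F := by rw [hardyConst, mul_assoc]

theorem variation_condExp_le_approxNorm (hw : IsGeometricWeight ℱ μ r R w) (hp : 1 ≤ p)
    (hq : 1 ≤ q) (u : Ω → E) :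
    variation μ w p q (fun n => μ[u | ℱ n]) ≤ hardyConst r R * approxNorm ℱ μ w p q u := by
  have hK : hardyConst r R ≠ 0 := (one_pos.trans_le (one_le_hardyConst r R)).ne'
  have hK_top := hw.hardyConst_lt_top.ne
  simp only [approxNorm, ENNReal.mul_iInf_of_ne hK hK_top]
  exact le_iInf₂ fun F hF => hw.variation_condExp_le hp hq hF

theorem approxNorm_mul_le {A : Type*} [NormedRing A] [NormedAlgebra ℝ A] [CompleteSpace A]
    {f g : Ω → A} (hw : IsGeometricWeight ℱ μ r R w) (hℱ : ⨆ n, ℱ n = mΩ) (hp : 1 ≤ p)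
    (hp_top : p ≠ ∞) (hq : 1 ≤ q) (hf : MemLp f ∞ μ) (hg : MemLp g ∞ μ) :
    approxNorm ℱ μ w p q (f * g) ≤ hardyConst r R *
      (eLpNorm g ∞ μ * approxNorm ℱ μ w p q f + eLpNorm f ∞ μ * approxNorm ℱ μ w p q g) := by
  have hF := isAdaptedApprox_condExp hℱ hp hp_top (hf.mono_exponent le_top)
  have hG := isAdaptedApprox_condExp hℱ hp hp_top (hg.mono_exponent le_top)
  have hFG := hF.mul hp hG hf.2.ne (fun n => eLpNorm_condExp_le_eLpNorm f le_top)
    (fun n => hg.condExp le_top) hg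
  calc approxNorm ℱ μ w p q (f * g)
      ≤ eLpNorm g ∞ μ * variation μ w p q (fun n => μ[f | ℱ n]) +
          eLpNorm f ∞ μ * variation μ w p q (fun n => μ[g | ℱ n]) :=
        hFG.approxNorm_le.trans (variation_mul_le hp hq hw.aestronglyMeasurable
          hF.aestronglyMeasurable hG.aestronglyMeasurable
          (fun n => eLpNorm_condExp_le_eLpNorm f le_top)
          fun n => eLpNorm_condExp_le_eLpNorm g le_top)
    _ ≤ eLpNorm g ∞ μ * (hardyConst r R * approxNorm ℱ μ w p q f) +
          eLpNorm f ∞ μ * (hardyConst r R * approxNorm ℱ μ w p q g) := by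
        gcongr <;> exact hw.variation_condExp_le_approxNorm hp hq _
    _ = _ := by ring

theorem tendsto_eLpNorm_smul_increment_condExp (hw : IsGeometricWeight ℱ μ r R w) (hp : 1 ≤ p)
    {v : ℕ → Ω → E} (hv : ∀ n, MemLp (v n) p μ) (hu : MemLp u p μ)
    (hlim : Tendsto (fun n => eLpNorm (v n - u) p μ) atTop (𝓝 0)) (k : ℕ) :
    Tendsto (fun n => eLpNorm (w k • increment (fun j => μ[v n | ℱ j]) k) p μ) atTop
      (𝓝 (eLpNorm (w k • increment (fun j => μ[u | ℱ j]) k) p μ)) := by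
  have hmem {f : Ω → E} (hf : MemLp f p μ) :
      MemLp (w k • increment (fun j => μ[f | ℱ j]) k) p μ :=
    (memLp_increment (fun _ => hf.condExp hp) k).smul (hw.memLp_top k)
  refine tendsto_eLpNorm_of_tendsto_eLpNorm_sub hp (fun n => hmem (hv n)) (hmem hu) ?_
  refine tendsto_of_tendsto_of_tendsto_of_le_of_le tendsto_const_nhds (h := fun n =>
    (1 + R * r) * eLpNorm (w k • (v n - u)) p μ) ?_ (fun _ => zero_le) fun n => ?_
  · simpa using ENNReal.Tendsto.const_mul
      (hw.tendsto_eLpNorm_smul (fun n => (hv n).1.sub hu.1) k hlim) (Or.inr (by finiteness))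
  · simp only [← smul_sub]
    refine (eLpNorm_congr_ae (EventuallyEq.rfl.smul
      (increment_condExp_sub hp (hv n) hu k))).symm.le.trans ?_
    exact hw.eLpNorm_smul_increment_condExp_le hp ((hv n).sub hu) k

theorem approxNorm_le_of_tendsto (hw : IsGeometricWeight ℱ μ r R w) (hℱ : ⨆ n, ℱ n = mΩ)
    (hp : 1 ≤ p) (hp_top : p ≠ ∞) (hq : 1 ≤ q) {v : ℕ → Ω → E} (hv : ∀ n, MemLp (v n) p μ)
    (hu : MemLp u p μ) (hlim : Tendsto (fun n => eLpNorm (v n - u) p μ) atTop (𝓝 0)) {C : ℝ≥0∞}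
    (hC : ∀ᶠ n in atTop, approxNorm ℱ μ w p q (v n) ≤ C) :
    approxNorm ℱ μ w p q u ≤ hardyConst r R * C := by
  refine (isAdaptedApprox_condExp hℱ hp hp_top hu).approxNorm_le.trans ?_
  refine eLpNorm_ennreal_le_of_ae_tendsto (f := fun n k =>
    eLpNorm (w k • increment (fun j => μ[v n | ℱ j]) k) p μ)
    (fun n => Measurable.of_discrete.aemeasurable)
    (ae_of_all _ fun k => hw.tendsto_eLpNorm_smul_increment_condExp hp hv hu hlim k) ?_
  exact hC.mono fun n hn => (hw.variation_condExp_le_approxNorm hp hq (v n)).trans (by gcongr)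

end IsGeometricWeight

end MartingaleNorm

section GridSteps

variable {I E : Type*} [mI : MeasurableSpace I] {m : Measure I} {𝓖 : Grid m} {c₁ c₂ : ℝ}
  {j k : ℕ} {A P Q : Set I} {x x' : I}

theorem Grid.nonempty_of_mem (hQ : Q ∈ 𝓖.sets k) : Q.Nonempty :=
  nonempty_of_measure_ne_zero (𝓖.measure_pos k Q hQ).ne'

namespace Grid.IsGood

theorem eq_of_mem (h𝓖 : 𝓖.IsGood c₁ c₂) (hP : P ∈ 𝓖.sets k) (hQ : Q ∈ 𝓖.sets k) (hxP : x ∈ P)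
    (hxQ : x ∈ Q) : P = Q :=
  of_not_not fun hne => Set.disjoint_left.1 (h𝓖.disjoint k P hP Q hQ hne) hxP hxQ

theorem ae_mem (h𝓖 : 𝓖.IsGood c₁ c₂) (k : ℕ) : ∀ᵐ x ∂m, ∃ Q ∈ 𝓖.sets k, x ∈ Q := by
  filter_upwards [compl_mem_ae_iff.2 (h𝓖.cover k)] with x hx
  simpa using hx

theorem exists_ancestor (h𝓖 : 𝓖.IsGood c₁ c₂) (hjk : j ≤ k) (hQ : Q ∈ 𝓖.sets k) :
    ∃ P ∈ 𝓖.sets j, Q ⊆ P := by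
  induction k, hjk using Nat.le_induction generalizing Q with
  | base => exact ⟨Q, hQ, subset_rfl⟩
  | succ k _ ih =>
    obtain ⟨R, hR, hQR⟩ := h𝓖.nested k Q hQ
    obtain ⟨P, hP, hRP⟩ := ih hR
    exact ⟨P, hP, hQR.trans hRP⟩

theorem subset_or_disjoint (h𝓖 : 𝓖.IsGood c₁ c₂) (hjk : j ≤ k) (hQ : Q ∈ 𝓖.sets k)
    (hP : P ∈ 𝓖.sets j) : Q ⊆ P ∨ Disjoint Q P := by
  obtain ⟨R, hR, hQR⟩ := h𝓖.exists_ancestor hjk hQ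
  rcases eq_or_ne R P with rfl | hne
  · exact Or.inl hQR
  · exact Or.inr ((h𝓖.disjoint j R hR P hP hne).mono_left hQR)

end Grid.IsGood

/-- The filtration of a grid: the `k`-th σ-algebra is generated by the sets of the levels up to
`k`. -/
def Grid.filtration (𝓖 : Grid m) : Filtration ℕ mI where
  seq k := MeasurableSpace.generateFrom {Q | ∃ j ≤ k, Q ∈ 𝓖.sets j}
  mono' _ _ hkl := MeasurableSpace.generateFrom_mono fun _ ⟨j, hj, hQ⟩ => ⟨j, hj.trans hkl, hQ⟩
  le' _ := MeasurableSpace.generateFrom_le fun Q ⟨j, _, hQ⟩ => 𝓖.measurableSet j Q hQ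

theorem Grid.measurableSet_filtration (hQ : Q ∈ 𝓖.sets k) : MeasurableSet[𝓖.filtration k] Q :=
  MeasurableSpace.measurableSet_generateFrom ⟨k, le_rfl, hQ⟩

namespace Grid.IsGood

theorem iSup_filtration (h𝓖 : 𝓖.IsGood c₁ c₂) : ⨆ k, 𝓖.filtration k = mI := by
  refine le_antisymm (iSup_le 𝓖.filtration.le) ?_
  conv_lhs => rw [← h𝓖.generate]
  exact MeasurableSpace.generateFrom_le fun Q ⟨k, hQ⟩ =>
    le_iSup 𝓖.filtration k Q (measurableSet_filtration hQ)

theorem subset_or_disjoint_of_measurableSet (h𝓖 : 𝓖.IsGood c₁ c₂) (hQ : Q ∈ 𝓖.sets k)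
    (hA : MeasurableSet[𝓖.filtration k] A) : Q ⊆ A ∨ Disjoint Q A := by
  induction A, hA using MeasurableSpace.generateFrom_induction with
  | hC P hP => exact h𝓖.subset_or_disjoint hP.choose_spec.1 hQ hP.choose_spec.2
  | empty => exact Or.inr (Set.disjoint_empty Q)
  | compl A _ ih =>
    exact ih.symm.imp Set.subset_compl_iff_disjoint_right.2 fun h => h.disjoint_compl_right
  | iUnion A _ ih =>
    by_cases h : ∃ n, Q ⊆ A n
    · exact Or.inl (h.choose_spec.trans (Set.subset_iUnion A _))
    · push Not at h
      exact Or.inr (Set.disjoint_iUnion_right.2 fun n => (ih n).resolve_left (h n))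

theorem apply_eq_of_stronglyMeasurable [TopologicalSpace E] [TopologicalSpace.MetrizableSpace E]
    (h𝓖 : 𝓖.IsGood c₁ c₂) {f : I → E} (hf : StronglyMeasurable[𝓖.filtration k] f)
    (hQ : Q ∈ 𝓖.sets k) (hx : x ∈ Q) (hx' : x' ∈ Q) : f x = f x' := by
  borelize E
  have hfiber : MeasurableSet[𝓖.filtration k] (f ⁻¹' {f x'}) :=
    hf.measurable (measurableSet_singleton _)
  rcases h𝓖.subset_or_disjoint_of_measurableSet hQ hfiber with h | h
  · exact h hx
  · exact absurd rfl (Set.disjoint_left.1 h hx')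

end Grid.IsGood

variable [NormedAddCommGroup E]

/-- The step function with value `v Q` on every set `Q` of level `k`. -/
noncomputable def Grid.step (𝓖 : Grid m) (k : ℕ) (v : Set I → E) : I → E :=
  ∑ Q ∈ 𝓖.sets k, Q.indicator fun _ => v Q

theorem Grid.stronglyMeasurable_step (𝓖 : Grid m) (k : ℕ) (v : Set I → E) :
    StronglyMeasurable[𝓖.filtration k] (𝓖.step k v) :=
  Finset.stronglyMeasurable_sum _ fun _ hQ =>
    stronglyMeasurable_const.indicator (measurableSet_filtration hQ)

theorem Grid.memLp_step [IsFiniteMeasure m] (𝓖 : Grid m) (k : ℕ) (v : Set I → E) (p : ℝ≥0∞) :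
    MemLp (𝓖.step k v) p m :=
  memLp_finsetSum' _ fun Q hQ => (memLp_const (v Q)).indicator (𝓖.measurableSet k Q hQ)

theorem Grid.step_apply_of_forall_notMem (v : Set I → E) (hx : ∀ Q ∈ 𝓖.sets k, x ∉ Q) :
    𝓖.step k v x = 0 := by
  rw [step, Finset.sum_apply]
  exact Finset.sum_eq_zero fun Q hQ => Set.indicator_of_notMem (hx Q hQ) _

namespace Grid.IsGood

theorem step_apply (h𝓖 : 𝓖.IsGood c₁ c₂) (v : Set I → E) (hQ : Q ∈ 𝓖.sets k) (hx : x ∈ Q) :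
    𝓖.step k v x = v Q := by
  rw [step, Finset.sum_apply, Finset.sum_eq_single_of_mem Q hQ, Set.indicator_of_mem hx]
  exact fun P hP hne => Set.indicator_of_notMem (fun hxP => hne (h𝓖.eq_of_mem hP hQ hxP hx)) _

theorem step_smul_step [NormedSpace ℝ E] (h𝓖 : 𝓖.IsGood c₁ c₂) (k : ℕ) (a : Set I → ℝ)
    (v : Set I → E) : 𝓖.step k a • 𝓖.step k v = 𝓖.step k (a • v) := by
  ext x
  by_cases hx : ∃ Q ∈ 𝓖.sets k, x ∈ Q
  · obtain ⟨Q, hQ, hxQ⟩ := hx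
    simp only [Pi.smul_apply', h𝓖.step_apply _ hQ hxQ]
  · push Not at hx
    simp only [Pi.smul_apply', step_apply_of_forall_notMem _ hx, smul_zero]

theorem eLpNorm_step (h𝓖 : 𝓖.IsGood c₁ c₂) {p : ℝ} (hp : 0 < p) (k : ℕ) (v : Set I → E) :
    eLpNorm (𝓖.step k v) (ENNReal.ofReal p) m = (∑ Q ∈ 𝓖.sets k, ‖v Q‖ₑ ^ p * m Q) ^ (1 / p) := by
  rw [eLpNorm_eq_lintegral_rpow_enorm_toReal (by simpa using hp) ENNReal.ofReal_ne_top,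
    ENNReal.toReal_ofReal hp.le]
  congr 1
  have hsum : ∀ᵐ x ∂m, ‖𝓖.step k v x‖ₑ ^ p =
      ∑ Q ∈ 𝓖.sets k, Q.indicator (fun _ => ‖v Q‖ₑ ^ p) x := by
    filter_upwards [h𝓖.ae_mem k] with x ⟨Q, hQ, hx⟩
    rw [h𝓖.step_apply v hQ hx, Finset.sum_eq_single_of_mem Q hQ, Set.indicator_of_mem hx]
    exact fun P hP hne => Set.indicator_of_notMem (fun hxP => hne (h𝓖.eq_of_mem hP hQ hxP hx)) _
  rw [lintegral_congr_ae hsum,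
    lintegral_finsetSum _ fun Q hQ => measurable_const.indicator (𝓖.measurableSet k Q hQ)]
  exact Finset.sum_congr rfl fun Q hQ => lintegral_indicator_const (𝓖.measurableSet k Q hQ) _

theorem exists_ae_eq_step (h𝓖 : 𝓖.IsGood c₁ c₂) {F : ℕ → I → E}
    (hF : StronglyAdapted 𝓖.filtration F) : ∃ v : Set I → E, ∀ k, F k =ᵐ[m] 𝓖.step k v := by
  have hconst (Q : Set I) : ∃ z : E, ∀ k, Q ∈ 𝓖.sets k → ∀ x ∈ Q, F k x = z := by
    by_cases hQ : ∃ k, Q ∈ 𝓖.sets k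
    · obtain ⟨k, hQ⟩ := hQ
      obtain ⟨x, hx⟩ := nonempty_of_mem hQ
      refine ⟨F k x, fun j hQ' x' hx' => ?_⟩
      obtain rfl : j = k := of_not_not fun hne => 𝓖.ne_of_level_ne j k hne Q hQ' Q hQ rfl
      exact h𝓖.apply_eq_of_stronglyMeasurable (hF j) hQ hx' hx
    · exact ⟨0, fun k hk => absurd ⟨k, hk⟩ hQ⟩
  choose v hv using hconst
  refine ⟨v, fun k => ?_⟩
  filter_upwards [h𝓖.ae_mem k] with x ⟨Q, hQ, hx⟩
  rw [h𝓖.step_apply v hQ hx, hv Q k hQ x hx]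

end Grid.IsGood

end GridSteps

section GridWeights

variable {I E : Type*} [mI : MeasurableSpace I] {m : Measure I} {𝓖 : Grid m}
  {c₁ c₂ s p : ℝ} {q : ℝ≥0∞} {k : ℕ} {P Q : Set I}

/-- The weight `|Q|^{-s}` on every set `Q` of level `k`. -/
noncomputable def Grid.scale (𝓖 : Grid m) (s : ℝ) (k : ℕ) : I → ℝ :=
  𝓖.step k fun Q => m.real Q ^ (-s)

theorem Grid.IsGood.scale_zero_apply (h𝓖 : 𝓖.IsGood c₁ c₂) (s : ℝ) (x : I) :
    𝓖.scale s 0 x = m.real Set.univ ^ (-s) :=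
  h𝓖.step_apply _ (by simp [h𝓖.level_zero]) (Set.mem_univ x)

variable [IsFiniteMeasure m]

theorem Grid.measureReal_pos (hQ : Q ∈ 𝓖.sets k) : 0 < m.real Q :=
  ENNReal.toReal_pos (𝓖.measure_pos k Q hQ).ne' (measure_ne_top m Q)

namespace Grid.IsGood

theorem rpow_neg_le_parent (h𝓖 : 𝓖.IsGood c₁ c₂) (hs : 0 ≤ s) (hQ : Q ∈ 𝓖.sets (k + 1))
    (hP : P ∈ 𝓖.sets k) (hQP : Q ⊆ P) : m.real Q ^ (-s) ≤ c₁ ^ (-s) * m.real P ^ (-s) := by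
  have hP0 := measureReal_pos hP
  rw [← Real.mul_rpow h𝓖.pos.le hP0.le]
  exact Real.rpow_le_rpow_of_nonpos (mul_pos h𝓖.pos hP0)
    ((le_div_iff₀ hP0).1 (h𝓖.ratio k Q hQ P hP hQP).1) (neg_nonpos.2 hs)

theorem rpow_neg_parent_le (h𝓖 : 𝓖.IsGood c₁ c₂) (hs : 0 ≤ s) (hQ : Q ∈ 𝓖.sets (k + 1))
    (hP : P ∈ 𝓖.sets k) (hQP : Q ⊆ P) : m.real P ^ (-s) ≤ c₂ ^ s * m.real Q ^ (-s) := by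
  have hP0 := measureReal_pos hP
  have hQ0 := measureReal_pos hQ
  have hle : m.real Q ^ s ≤ c₂ ^ s * m.real P ^ s := by
    rw [← Real.mul_rpow (h𝓖.pos.trans h𝓖.lt).le hP0.le]
    exact Real.rpow_le_rpow hQ0.le ((div_le_iff₀ hP0).1 (h𝓖.ratio k Q hQ P hP hQP).2) hs
  rw [Real.rpow_neg hP0.le, Real.rpow_neg hQ0.le, ← div_eq_mul_inv, le_div_iff₀ (by positivity),
    inv_mul_le_iff₀ (by positivity), mul_comm]
  exact hle

theorem isGeometricWeight_scale (h𝓖 : 𝓖.IsGood c₁ c₂) (hs : 0 < s) :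
    IsGeometricWeight 𝓖.filtration m (c₂ ^ s).toNNReal (c₁ ^ (-s)).toNNReal (𝓖.scale s) where
  adapted k := 𝓖.stronglyMeasurable_step k _
  memLp_top k := 𝓖.memLp_step k _ ∞
  le_succ k := by
    filter_upwards [h𝓖.ae_mem (k + 1)] with x ⟨Q, hQ, hx⟩
    obtain ⟨P, hP, hQP⟩ := h𝓖.nested k Q hQ
    rw [scale, scale, h𝓖.step_apply _ hQ hx, h𝓖.step_apply _ hP (hQP hx),
      Real.enorm_of_nonneg (by positivity), Real.enorm_of_nonneg (by positivity)]
    refine (ENNReal.ofReal_le_ofReal (h𝓖.rpow_neg_parent_le hs.le hQ hP hQP)).trans ?_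
    exact (ENNReal.ofReal_mul (Real.rpow_nonneg (h𝓖.pos.trans h𝓖.lt).le s)).le
  succ_le k := by
    filter_upwards [h𝓖.ae_mem (k + 1)] with x ⟨Q, hQ, hx⟩
    obtain ⟨P, hP, hQP⟩ := h𝓖.nested k Q hQ
    rw [scale, scale, h𝓖.step_apply _ hQ hx, h𝓖.step_apply _ hP (hQP hx),
      Real.enorm_of_nonneg (by positivity), Real.enorm_of_nonneg (by positivity)]
    refine (ENNReal.ofReal_le_ofReal (h𝓖.rpow_neg_le_parent hs.le hQ hP hQP)).trans ?_
    exact (ENNReal.ofReal_mul (Real.rpow_nonneg h𝓖.pos.le (-s))).le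
  ratio_lt_one := by
    rw [Real.toNNReal_lt_one]
    exact Real.rpow_lt_one (h𝓖.pos.trans h𝓖.lt).le h𝓖.lt_one hs

variable [NormedAddCommGroup E] [NormedSpace ℝ E]

theorem eLpNorm_le_scale_smul (h𝓖 : 𝓖.IsGood c₁ c₂) (hs : 0 < s) (k : ℕ) (f : I → E) :
    eLpNorm f q m ≤ ENNReal.ofReal (m.real Set.univ ^ s) *
      ((c₂ ^ s).toNNReal ^ k * eLpNorm (𝓖.scale s k • f) q m) := by
  have hI : 0 < m.real Set.univ := measureReal_pos (𝓖 := 𝓖) (k := 0) (by simp [h𝓖.level_zero])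
  have hf : f = (m.real Set.univ ^ s) • (𝓖.scale s 0 • f) := by
    ext x
    rw [Pi.smul_apply, Pi.smul_apply', h𝓖.scale_zero_apply, smul_smul, ← Real.rpow_add hI,
      add_neg_cancel, Real.rpow_zero, one_smul]
  nth_rewrite 1 [hf]
  rw [eLpNorm_const_smul, Real.enorm_of_nonneg (by positivity)]
  gcongr
  rw [← ENNReal.coe_pow]
  refine eLpNorm_smul_le_of_weight_le ?_ f
  simpa only [zero_add] using (h𝓖.isGeometricWeight_scale hs).le_pow 0 k

theorem tsum_eLpNorm_lt_top (h𝓖 : 𝓖.IsGood c₁ c₂) (hs : 0 < s) {p : ℝ≥0∞} (hq : 1 ≤ q)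
    {f : ℕ → I → E}
    (hf : eLpNorm (fun k => eLpNorm (𝓖.scale s k • f k) p m) q Measure.count < ∞) :
    ∑' k, eLpNorm (f k) p m < ∞ := by
  set r := (c₂ ^ s).toNNReal
  set N := eLpNorm (fun k => eLpNorm (𝓖.scale s k • f k) p m) q Measure.count
  have hr : (1 : ℝ≥0∞) - r ≠ 0 :=
    (tsub_pos_of_lt (by exact_mod_cast (h𝓖.isGeometricWeight_scale hs).ratio_lt_one)).ne'
  calc ∑' k, eLpNorm (f k) p m
      ≤ ∑' k, ENNReal.ofReal (m.real Set.univ ^ s) * ((r : ℝ≥0∞) ^ k * N) := by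
        refine ENNReal.tsum_le_tsum fun k => (h𝓖.eLpNorm_le_scale_smul hs k (f k)).trans ?_
        gcongr
        exact enorm_le_eLpNorm_count (fun k => eLpNorm (𝓖.scale s k • f k) p m) k
          (one_pos.trans_le hq).ne'
    _ = ENNReal.ofReal (m.real Set.univ ^ s) * ((1 - (r : ℝ≥0∞))⁻¹ * N) := by
        rw [ENNReal.tsum_mul_left, ENNReal.tsum_mul_right, ENNReal.tsum_geometric]
    _ < ∞ := ENNReal.mul_lt_top ENNReal.ofReal_lt_top
        (ENNReal.mul_lt_top (ENNReal.inv_lt_top.2 (pos_iff_ne_zero.2 hr)) hf)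

theorem eLpNorm_scale_smul_step (h𝓖 : 𝓖.IsGood c₁ c₂) (hp : 0 < p) (s : ℝ) (k : ℕ)
    (v : Set I → E) :
    eLpNorm (𝓖.scale s k • 𝓖.step k v) (ENNReal.ofReal p) m =
      (∑ Q ∈ 𝓖.sets k, ‖m.real Q ^ (1 / p - s) • v Q‖ₑ ^ p) ^ (1 / p) := by
  rw [scale, h𝓖.step_smul_step, h𝓖.eLpNorm_step hp]
  congr 1
  refine Finset.sum_congr rfl fun Q hQ => ?_
  have hQ0 := measureReal_pos hQ
  have hm : m Q = ‖m.real Q ^ (1 / p)‖ₑ ^ p := by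
    rw [Real.enorm_of_nonneg (by positivity), ENNReal.ofReal_rpow_of_pos (by positivity),
      ← Real.rpow_mul hQ0.le, one_div_mul_cancel hp.ne', Real.rpow_one, ofReal_measureReal]
  rw [hm, ← ENNReal.mul_rpow_of_nonneg _ _ hp.le, mul_comm, ← enorm_smul, Pi.smul_apply',
    smul_smul, ← Real.rpow_add hQ0, sub_eq_add_neg]

end Grid.IsGood

end GridWeights

section AtomicRepresentations

variable {I : Type*} [mI : MeasurableSpace I] {m : Measure I} {𝓖 : Grid m}
  {c₁ c₂ s p : ℝ} {q : ℝ≥0∞} {k : ℕ} {Q : Set I} {u : I →ₘ[m] ℂ} {c : Set I → ℂ}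
  {a : Set I → I → ℂ} {F : ℕ → I → ℂ}

theorem Grid.mem_besov_iff : u ∈ 𝓖.besov s p q ↔ 𝓖.besovNorm s p q u < ∞ := by
  simp only [besovNorm, iInf_lt_iff]
  exact ⟨fun ⟨c, a, h⟩ => ⟨c, a, h, h.cost_lt_top⟩, fun ⟨c, a, h, _⟩ => ⟨c, a, h⟩⟩

theorem Grid.cost_eq_eLpNorm (𝓖 : Grid m) (p : ℝ) (hq : 1 ≤ q) (c : Set I → ℂ) :
    𝓖.cost p q c =
      eLpNorm (fun k => (∑ Q ∈ 𝓖.sets k, ‖c Q‖ₑ ^ p) ^ (1 / p)) q Measure.count := by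
  rw [cost]
  split_ifs with hq_top
  · rw [hq_top, eLpNorm_exponent_top, eLpNormEssSup, essSup_count]
    rfl
  · rw [eLpNorm_eq_lintegral_rpow_enorm_toReal (one_pos.trans_le hq).ne' hq_top, lintegral_count]
    simp only [enorm_eq_self, ← ENNReal.rpow_mul, one_div_mul_eq_div]

theorem enorm_le_of_mem_souzaAtoms (hQ : Q ∈ 𝓖.sets k) {b : I → ℂ} (hb : b ∈ souzaAtoms m s p Q)
    {z : ℂ} (hz : ∀ x ∈ Q, b x = z) : ‖z‖ₑ ≤ m Q ^ (s - 1 / p) := by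
  have hQ0 : m.restrict Q ≠ 0 := by simpa using (𝓖.measure_pos k Q hQ).ne'
  calc ‖z‖ₑ = eLpNorm (fun _ : I => z) ∞ (m.restrict Q) := by
        rw [eLpNorm_const _ (by simp) hQ0]
        simp
    _ = eLpNorm b ∞ (m.restrict Q) := eLpNorm_congr_ae
        ((ae_restrict_mem (𝓖.measurableSet k Q hQ)).mono fun x hx => (hz x hx).symm)
    _ ≤ m Q ^ (s - 1 / p) := (eLpNorm_mono_measure _ Measure.restrict_le_self).trans hb.2.2

theorem Grid.IsRep.exists_eq_step [IsFiniteMeasure m]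
    (h : 𝓖.IsRep (souzaAtoms m s p) p q u c a) :
    ∃ y : Set I → ℂ, (∀ k, ∀ Q ∈ 𝓖.sets k, ‖m.real Q ^ (1 / p - s) • y Q‖ₑ ≤ ‖c Q‖ₑ) ∧
      ∀ k, (fun x => ∑ Q ∈ 𝓖.sets k, c Q * a Q x) = 𝓖.step k y := by
  have hconst (Q : Set I) : ∃ z : ℂ, ∀ k, Q ∈ 𝓖.sets k → ∀ x ∈ Q, a Q x = z := by
    by_cases hQ : ∃ k, Q ∈ 𝓖.sets k
    · obtain ⟨k, hQ⟩ := hQ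
      obtain ⟨z, hz⟩ := (h.atom k Q hQ).2.1
      exact ⟨z, fun _ _ => hz⟩
    · exact ⟨0, fun k hk => absurd ⟨k, hk⟩ hQ⟩
  choose z hz using hconst
  refine ⟨fun Q => c Q * z Q, fun k Q hQ => ?_, fun k => ?_⟩
  · have hQ0 := measureReal_pos hQ
    have hz_le : ‖m.real Q ^ (1 / p - s)‖ₑ * ‖z Q‖ₑ ≤ 1 := by
      calc ‖m.real Q ^ (1 / p - s)‖ₑ * ‖z Q‖ₑ ≤ m Q ^ (1 / p - s) * m Q ^ (s - 1 / p) := by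
            gcongr
            · rw [Real.enorm_of_nonneg (by positivity), ← ENNReal.ofReal_rpow_of_pos hQ0,
                ofReal_measureReal]
            · exact enorm_le_of_mem_souzaAtoms hQ (h.atom k Q hQ) (hz Q k hQ)
        _ = 1 := by
            rw [← ENNReal.rpow_add _ _ (𝓖.measure_pos k Q hQ).ne' (measure_ne_top m Q)]
            simp
    calc ‖m.real Q ^ (1 / p - s) • (c Q * z Q)‖ₑ
        = ‖c Q‖ₑ * (‖m.real Q ^ (1 / p - s)‖ₑ * ‖z Q‖ₑ) := by
          rw [enorm_smul, enorm_mul, mul_left_comm]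
      _ ≤ ‖c Q‖ₑ := mul_le_of_le_one_right' hz_le
  · ext x
    rw [step, Finset.sum_apply]
    refine Finset.sum_congr rfl fun Q hQ => ?_
    by_cases hx : x ∈ Q
    · rw [Set.indicator_of_mem hx, hz Q k hQ x hx]
    · rw [Set.indicator_of_notMem hx, (h.atom k Q hQ).1 x hx, mul_zero]

variable [IsFiniteMeasure m]

theorem Grid.isAdaptedApprox_of_tendsto_sum_step {f : I → ℂ} {y : Set I → ℂ} {p : ℝ≥0∞}
    (hf : MemLp f p m)
    (hlim : Tendsto (fun n => eLpNorm (f - ∑ k ∈ Finset.range n, 𝓖.step k y) p m) atTop (𝓝 0)) :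
    IsAdaptedApprox 𝓖.filtration m p (fun n => ∑ k ∈ Finset.range (n + 1), 𝓖.step k y) f where
  adapted _ := Finset.stronglyMeasurable_sum _ fun k hk => (𝓖.stronglyMeasurable_step k y).mono
    (𝓖.filtration.mono (Nat.lt_succ_iff.1 (Finset.mem_range.1 hk)))
  memLp _ := memLp_finsetSum' _ fun k _ => 𝓖.memLp_step k y p
  memLp_limit := hf
  tendsto := hlim.comp (tendsto_add_atTop_nat 1)

/-- The atom with value `|Q|^{s - 1/p}` on `Q`, of which all Souza atoms on `Q` are multiples. -/
noncomputable def canonicalAtom (m : Measure I) (s p : ℝ) (Q : Set I) : I → ℂ :=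
  Q.indicator fun _ => ((m.real Q ^ (s - 1 / p) : ℝ) : ℂ)

theorem canonicalAtom_mem_souzaAtoms (hQ : Q ∈ 𝓖.sets k) :
    canonicalAtom m s p Q ∈ souzaAtoms m s p Q := by
  refine ⟨fun x hx => Set.indicator_of_notMem hx _, ⟨_, fun x hx => Set.indicator_of_mem hx _⟩, ?_⟩
  have hQ0 := Grid.measureReal_pos hQ
  calc eLpNorm (canonicalAtom m s p Q) ∞ m
      ≤ ‖((m.real Q ^ (s - 1 / p) : ℝ) : ℂ)‖ₑ := by
        rw [eLpNorm_exponent_top]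
        exact eLpNormEssSup_indicator_const_le Q _
    _ = m Q ^ (s - 1 / p) := by
        rw [← ofReal_norm, Complex.norm_real, Real.norm_of_nonneg (by positivity),
          ← ENNReal.ofReal_rpow_of_pos hQ0, ofReal_measureReal]

theorem Grid.sum_mul_canonicalAtom (𝓖 : Grid m) (s p : ℝ) (k : ℕ) (y : Set I → ℂ) :
    (fun x => ∑ Q ∈ 𝓖.sets k, m.real Q ^ (1 / p - s) • y Q * canonicalAtom m s p Q x) =
      𝓖.step k y := by
  ext x
  rw [step, Finset.sum_apply]
  refine Finset.sum_congr rfl fun Q hQ => ?_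
  by_cases hx : x ∈ Q
  · rw [canonicalAtom, Set.indicator_of_mem hx, Set.indicator_of_mem hx, smul_mul_assoc, mul_comm,
      ← Complex.real_smul, smul_smul, ← Real.rpow_add (measureReal_pos hQ)]
    simp
  · rw [canonicalAtom, Set.indicator_of_notMem hx, Set.indicator_of_notMem hx, mul_zero]

namespace Grid.IsGood

theorem approxNorm_le_cost (h𝓖 : 𝓖.IsGood c₁ c₂) (hp : 0 < p) (hq : 1 ≤ q)
    (h : 𝓖.IsRep (souzaAtoms m s p) p q u c a) :
    approxNorm 𝓖.filtration m (𝓖.scale s) (ENNReal.ofReal p) q u ≤ 𝓖.cost p q c := by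
  obtain ⟨y, hy, hstep⟩ := h.exists_eq_step
  have hF : IsAdaptedApprox 𝓖.filtration m (ENNReal.ofReal p)
      (fun n => ∑ k ∈ Finset.range (n + 1), 𝓖.step k y) u := by
    refine isAdaptedApprox_of_tendsto_sum_step h.memLp (h.tendsto.congr fun n => ?_)
    congr 1
    ext x
    simp only [Pi.sub_apply, Finset.sum_apply, ← hstep]
  refine hF.approxNorm_le.trans ?_
  rw [cost_eq_eLpNorm 𝓖 p hq]
  refine eLpNorm_mono_enorm fun k => ?_
  simp only [increment_partialSum, h𝓖.eLpNorm_scale_smul_step hp, enorm_eq_self]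
  gcongr with Q hQ
  exact hy k Q hQ

theorem exists_isRep (h𝓖 : 𝓖.IsGood c₁ c₂) (hs : 0 < s) (hp : 1 ≤ p) (hq : 1 ≤ q)
    (hF : IsAdaptedApprox 𝓖.filtration m (ENNReal.ofReal p) F u)
    (hF_top : variation m (𝓖.scale s) (ENNReal.ofReal p) q F < ∞) :
    ∃ c a, 𝓖.IsRep (souzaAtoms m s p) p q u c a ∧
      𝓖.cost p q c = variation m (𝓖.scale s) (ENNReal.ofReal p) q F := by
  have hp0 : 0 < p := one_pos.trans_le hp
  obtain ⟨y, hy⟩ := h𝓖.exists_ae_eq_step (stronglyAdapted_increment hF.adapted)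
  let c : Set I → ℂ := fun Q => m.real Q ^ (1 / p - s) • y Q
  have hstep (k : ℕ) : (fun x => ∑ Q ∈ 𝓖.sets k, c Q * canonicalAtom m s p Q x) = 𝓖.step k y :=
    𝓖.sum_mul_canonicalAtom s p k y
  have hcost : 𝓖.cost p q c = variation m (𝓖.scale s) (ENNReal.ofReal p) q F := by
    rw [cost_eq_eLpNorm 𝓖 p hq, variation]
    congr 1
    ext k
    exact (h𝓖.eLpNorm_scale_smul_step hp0 s k y).symm.trans
      (eLpNorm_congr_ae ((EventuallyEq.refl _ (𝓖.scale s k)).smul (hy k).symm))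
  refine ⟨c, canonicalAtom m s p, ⟨hF.memLp_limit, fun k Q hQ => canonicalAtom_mem_souzaAtoms hQ,
    hcost.trans_lt hF_top, ?absConv, ?tendsto⟩, hcost⟩
  case absConv =>
    simp only [hstep, max_eq_left hp, div_self hp0.ne', ENNReal.rpow_one,
      ← eLpNorm_congr_ae (hy _)]
    exact h𝓖.tsum_eLpNorm_lt_top hs hq hF_top
  case tendsto =>
    refine (tendsto_add_atTop_iff_nat 1).1 (hF.tendsto.congr fun n => eLpNorm_congr_ae ?_)
    filter_upwards [ae_all_iff.2 hy] with x hx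
    have hsum : ∑ k ∈ Finset.range (n + 1), increment F k x = F n x := by
      simpa [previous] using congrFun (sum_range_increment F 0 (n + 1)) x
    simp only [Pi.sub_apply, ← hsum, hx, ← hstep]

theorem besovNorm_eq_approxNorm (h𝓖 : 𝓖.IsGood c₁ c₂) (hs : 0 < s) (hp : 1 ≤ p) (hq : 1 ≤ q)
    (u : I →ₘ[m] ℂ) : 𝓖.besovNorm s p q u =
      approxNorm 𝓖.filtration m (𝓖.scale s) (ENNReal.ofReal p) q u := by
  refine le_antisymm (le_iInf₂ fun F hF => ?_) (le_iInf₂ fun c a => le_iInf fun h =>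
    h𝓖.approxNorm_le_cost (one_pos.trans_le hp) hq h)
  rcases eq_or_ne (variation m (𝓖.scale s) (ENNReal.ofReal p) q F) ∞ with hF_top | hF_top
  · simp [hF_top]
  · obtain ⟨c, a, h, hc⟩ := h𝓖.exists_isRep hs hp hq hF hF_top.lt_top
    exact (iInf₂_le_of_le c a (iInf_le _ h)).trans hc.le

end Grid.IsGood

end AtomicRepresentations

section BesovAlgebra

variable {I : Type*} [mI : MeasurableSpace I] {m : Measure I} {𝓖 : Grid m} {c₁ c₂ s p : ℝ}
  {q : ℝ≥0∞} {f g : I →ₘ[m] ℂ}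

theorem Grid.mem_besovLinfty_iff :
    f ∈ 𝓖.besovLinfty s p q ↔ 𝓖.besovLinftyNorm s p q f < ∞ := by
  rw [besovLinftyNorm, ENNReal.add_lt_top, ← mem_besov_iff]
  exact and_congr_right fun _ => and_iff_right f.aestronglyMeasurable

/-- The factor lost by passing from atomic representations to conditional expectations on the
levels of a `(c₁, c₂)`-good grid. -/
noncomputable def gridConst (c₁ c₂ s : ℝ) : ℝ≥0∞ :=
  hardyConst (c₂ ^ s).toNNReal (c₁ ^ (-s)).toNNReal

variable [IsFiniteMeasure m]

namespace Grid.IsGood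

theorem besovNorm_zero (h𝓖 : 𝓖.IsGood c₁ c₂) (hs : 0 < s) (hp : 1 ≤ p) (hq : 1 ≤ q) :
    𝓖.besovNorm s p q 0 = 0 := by
  rw [h𝓖.besovNorm_eq_approxNorm hs hp hq, approxNorm_congr_ae AEEqFun.coeFn_zero, approxNorm_zero]

theorem besovNorm_add_le (h𝓖 : 𝓖.IsGood c₁ c₂) (hs : 0 < s) (hp : 1 ≤ p) (hq : 1 ≤ q)
    (f g : I →ₘ[m] ℂ) :
    𝓖.besovNorm s p q (f + g) ≤ 𝓖.besovNorm s p q f + 𝓖.besovNorm s p q g := by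
  simp only [h𝓖.besovNorm_eq_approxNorm hs hp hq]
  rw [approxNorm_congr_ae (AEEqFun.coeFn_add f g)]
  exact approxNorm_add_le (ENNReal.one_le_ofReal.2 hp) hq
    (h𝓖.isGeometricWeight_scale hs).aestronglyMeasurable _ _

theorem besovNorm_smul (h𝓖 : 𝓖.IsGood c₁ c₂) (hs : 0 < s) (hp : 1 ≤ p) (hq : 1 ≤ q)
    (z : ℂ) (f : I →ₘ[m] ℂ) : 𝓖.besovNorm s p q (z • f) = ‖z‖ₑ * 𝓖.besovNorm s p q f := by
  simp only [h𝓖.besovNorm_eq_approxNorm hs hp hq]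
  rw [approxNorm_congr_ae (AEEqFun.coeFn_smul z f), approxNorm_const_smul]

theorem gridConst_lt_top (h𝓖 : 𝓖.IsGood c₁ c₂) (hs : 0 < s) : gridConst c₁ c₂ s < ∞ :=
  (h𝓖.isGeometricWeight_scale hs).hardyConst_lt_top

theorem besovNorm_mul_le (h𝓖 : 𝓖.IsGood c₁ c₂) (hs : 0 < s) (hp : 1 ≤ p) (hq : 1 ≤ q)
    (hf : MemLp f ∞ m) (hg : MemLp g ∞ m) :
    𝓖.besovNorm s p q (f * g) ≤ gridConst c₁ c₂ s *
      (eLpNorm g ∞ m * 𝓖.besovNorm s p q f + eLpNorm f ∞ m * 𝓖.besovNorm s p q g) := by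
  simp only [h𝓖.besovNorm_eq_approxNorm hs hp hq]
  rw [approxNorm_congr_ae (AEEqFun.coeFn_mul f g)]
  exact (h𝓖.isGeometricWeight_scale hs).approxNorm_mul_le h𝓖.iSup_filtration
    (ENNReal.one_le_ofReal.2 hp) ENNReal.ofReal_ne_top hq hf hg

theorem besovNorm_le_of_tendsto (h𝓖 : 𝓖.IsGood c₁ c₂) (hs : 0 < s) (hp : 1 ≤ p) (hq : 1 ≤ q)
    {v : ℕ → I →ₘ[m] ℂ} (hv : ∀ n, MemLp (v n) (ENNReal.ofReal p) m)
    (hf : MemLp f (ENNReal.ofReal p) m)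
    (hlim : Tendsto (fun n => eLpNorm (v n - f : I →ₘ[m] ℂ) (ENNReal.ofReal p) m) atTop (𝓝 0))
    {C : ℝ≥0∞} (hC : ∀ᶠ n in atTop, 𝓖.besovNorm s p q (v n) ≤ C) :
    𝓖.besovNorm s p q f ≤ gridConst c₁ c₂ s * C := by
  simp only [h𝓖.besovNorm_eq_approxNorm hs hp hq] at hC ⊢
  exact (h𝓖.isGeometricWeight_scale hs).approxNorm_le_of_tendsto h𝓖.iSup_filtration
    (ENNReal.one_le_ofReal.2 hp) ENNReal.ofReal_ne_top hq hv hf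
    (hlim.congr fun n => eLpNorm_congr_ae (AEEqFun.coeFn_sub (v n) f)) hC

theorem besovLinftyNorm_zero (h𝓖 : 𝓖.IsGood c₁ c₂) (hs : 0 < s) (hp : 1 ≤ p) (hq : 1 ≤ q) :
    𝓖.besovLinftyNorm s p q 0 = 0 := by
  rw [besovLinftyNorm, h𝓖.besovNorm_zero hs hp hq, eLpNorm_congr_ae AEEqFun.coeFn_zero,
    eLpNorm_zero, add_zero]

theorem besovLinftyNorm_add_le (h𝓖 : 𝓖.IsGood c₁ c₂) (hs : 0 < s) (hp : 1 ≤ p) (hq : 1 ≤ q)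
    (f g : I →ₘ[m] ℂ) : 𝓖.besovLinftyNorm s p q (f + g) ≤
      𝓖.besovLinftyNorm s p q f + 𝓖.besovLinftyNorm s p q g := by
  have htop : eLpNorm (f + g : I →ₘ[m] ℂ) ∞ m ≤ eLpNorm f ∞ m + eLpNorm g ∞ m := by
    rw [eLpNorm_congr_ae (AEEqFun.coeFn_add f g)]
    exact eLpNorm_add_le f.aestronglyMeasurable g.aestronglyMeasurable le_top
  exact (add_le_add (h𝓖.besovNorm_add_le hs hp hq f g) htop).trans_eq (add_add_add_comm _ _ _ _)

theorem besovLinftyNorm_smul (h𝓖 : 𝓖.IsGood c₁ c₂) (hs : 0 < s) (hp : 1 ≤ p) (hq : 1 ≤ q)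
    (z : ℂ) (f : I →ₘ[m] ℂ) :
    𝓖.besovLinftyNorm s p q (z • f) = ‖z‖ₑ * 𝓖.besovLinftyNorm s p q f := by
  rw [besovLinftyNorm, h𝓖.besovNorm_smul hs hp hq, eLpNorm_congr_ae (AEEqFun.coeFn_smul z f),
    eLpNorm_const_smul, ← mul_add, besovLinftyNorm]

theorem besovLinftyNorm_mul_le (h𝓖 : 𝓖.IsGood c₁ c₂) (hs : 0 < s) (hp : 1 ≤ p) (hq : 1 ≤ q)
    (hf : MemLp f ∞ m) (hg : MemLp g ∞ m) :
    𝓖.besovLinftyNorm s p q (f * g) ≤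
      gridConst c₁ c₂ s * 𝓖.besovLinftyNorm s p q f * 𝓖.besovLinftyNorm s p q g := by
  have htop : eLpNorm (f * g : I →ₘ[m] ℂ) ∞ m ≤ eLpNorm f ∞ m * eLpNorm g ∞ m := by
    rw [eLpNorm_congr_ae (AEEqFun.coeFn_mul f g)]
    exact eLpNorm_smul_le_eLpNorm_top_mul_eLpNorm ∞ hg.1 f
  have hone : 1 ≤ gridConst c₁ c₂ s := one_le_hardyConst _ _
  calc 𝓖.besovLinftyNorm s p q (f * g)
      ≤ gridConst c₁ c₂ s *
          (eLpNorm g ∞ m * 𝓖.besovNorm s p q f + eLpNorm f ∞ m * 𝓖.besovNorm s p q g) +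
        gridConst c₁ c₂ s *
          (𝓖.besovNorm s p q f * 𝓖.besovNorm s p q g + eLpNorm f ∞ m * eLpNorm g ∞ m) :=
        add_le_add (h𝓖.besovNorm_mul_le hs hp hq hf hg)
          (htop.trans (le_add_self.trans (le_mul_of_one_le_left' hone)))
    _ = gridConst c₁ c₂ s * 𝓖.besovLinftyNorm s p q f * 𝓖.besovLinftyNorm s p q g := by
        simp only [besovLinftyNorm]
        ring

theorem mul_mem_besovLinfty (h𝓖 : 𝓖.IsGood c₁ c₂) (hs : 0 < s) (hp : 1 ≤ p) (hq : 1 ≤ q)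
    (hf : f ∈ 𝓖.besovLinfty s p q) (hg : g ∈ 𝓖.besovLinfty s p q) :
    f * g ∈ 𝓖.besovLinfty s p q :=
  mem_besovLinfty_iff.2 <| (h𝓖.besovLinftyNorm_mul_le hs hp hq hf.2 hg.2).trans_lt <|
    ENNReal.mul_lt_top (ENNReal.mul_lt_top (h𝓖.gridConst_lt_top hs) (mem_besovLinfty_iff.1 hf))
      (mem_besovLinfty_iff.1 hg)

end Grid.IsGood

end BesovAlgebra

section Completeness

variable {I : Type*} [mI : MeasurableSpace I] {m : Measure I} [IsFiniteMeasure m] {𝓖 : Grid m}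
  {c₁ c₂ s p : ℝ} {q : ℝ≥0∞}

namespace Grid.IsGood

theorem tendsto_besovNorm_sub (h𝓖 : 𝓖.IsGood c₁ c₂) (hs : 0 < s) (hp : 1 ≤ p) (hq : 1 ≤ q)
    {u : ℕ → I →ₘ[m] ℂ} {f : I →ₘ[m] ℂ} (hu : ∀ n, MemLp (u n) (ENNReal.ofReal p) m)
    (hf : MemLp f (ENNReal.ofReal p) m)
    (hlim : Tendsto (fun n => eLpNorm (u n - f : I →ₘ[m] ℂ) (ENNReal.ofReal p) m) atTop (𝓝 0))
    (hcauchy : ∀ ε : ℝ≥0∞, 0 < ε → ∃ N, ∀ i ≥ N, ∀ j ≥ N, 𝓖.besovNorm s p q (u i - u j) < ε) :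
    Tendsto (fun n => 𝓖.besovNorm s p q (u n - f)) atTop (𝓝 0) := by
  have hsub {g g' : I →ₘ[m] ℂ} (hg : MemLp g (ENNReal.ofReal p) m)
      (hg' : MemLp g' (ENNReal.ofReal p) m) :
      MemLp (g - g' : I →ₘ[m] ℂ) (ENNReal.ofReal p) m :=
    (hg.sub hg').ae_eq (AEEqFun.coeFn_sub g g').symm
  have hlim_sub (i : ℕ) : Tendsto (fun j => eLpNorm
      (u i - u j - (u i - f) : I →ₘ[m] ℂ) (ENNReal.ofReal p) m) atTop (𝓝 0) := by
    refine hlim.congr fun j => ?_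
    rw [sub_sub_sub_cancel_left, ← neg_sub (u j) f, eLpNorm_congr_ae (AEEqFun.coeFn_neg _),
      eLpNorm_neg]
  have hK : gridConst c₁ c₂ s ≠ 0 :=
    (one_pos.trans_le (one_le_hardyConst _ _)).ne'
  have hK_top := (h𝓖.gridConst_lt_top hs).ne
  refine ENNReal.tendsto_nhds_zero.2 fun ε hε => ?_
  obtain ⟨N, hN⟩ := hcauchy (ε / gridConst c₁ c₂ s) (ENNReal.div_pos hε.ne' hK_top)
  filter_upwards [eventually_ge_atTop N] with i hi
  calc 𝓖.besovNorm s p q (u i - f)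
      ≤ gridConst c₁ c₂ s * (ε / gridConst c₁ c₂ s) :=
        h𝓖.besovNorm_le_of_tendsto hs hp hq (fun j => hsub (hu i) (hu j)) (hsub (hu i) hf)
          (hlim_sub i) ((eventually_ge_atTop N).mono fun j hj => (hN i hi j hj).le)
    _ = ε := ENNReal.mul_div_cancel hK hK_top

theorem exists_tendsto_besovLinftyNorm_sub (h𝓖 : 𝓖.IsGood c₁ c₂) (hs : 0 < s) (hp : 1 ≤ p)
    (hq : 1 ≤ q) {u : ℕ → I →ₘ[m] ℂ} (hu : ∀ n, u n ∈ 𝓖.besovLinfty s p q)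
    (hcauchy : ∀ ε : ℝ≥0∞, 0 < ε → ∃ N, ∀ i ≥ N, ∀ j ≥ N,
      𝓖.besovLinftyNorm s p q (u i - u j) < ε) :
    ∃ f ∈ 𝓖.besovLinfty s p q,
      Tendsto (fun n => 𝓖.besovLinftyNorm s p q (u n - f)) atTop (𝓝 0) := by
  obtain ⟨f, hf, hlim⟩ := exists_tendsto_eLpNorm_sub le_top (fun n => (hu n).2) fun ε hε =>
    (hcauchy ε hε).imp fun N hN i hi j hj => le_add_self.trans_lt (hN i hi j hj)
  have hlim_besov : Tendsto (fun n => 𝓖.besovNorm s p q (u n - f)) atTop (𝓝 0) :=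
    h𝓖.tendsto_besovNorm_sub hs hp hq (fun n => (hu n).2.mono_exponent le_top)
      (hf.mono_exponent le_top)
      (tendsto_eLpNorm_of_tendsto_eLpNorm_top (fun n => (u n - f).aestronglyMeasurable) hlim)
      fun ε hε => (hcauchy ε hε).imp fun N hN i hi j hj => le_self_add.trans_lt (hN i hi j hj)
  have hlim_norm : Tendsto (fun n => 𝓖.besovLinftyNorm s p q (u n - f)) atTop (𝓝 0) := by
    simpa only [besovLinftyNorm, add_zero] using hlim_besov.add hlim
  refine ⟨f, mem_besovLinfty_iff.2 ?_, hlim_norm⟩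
  obtain ⟨n, hn⟩ := (hlim_norm.eventually_lt_const ENNReal.zero_lt_top).exists
  calc 𝓖.besovLinftyNorm s p q f
      = 𝓖.besovLinftyNorm s p q (u n + -(u n - f)) := by rw [neg_sub, add_sub_cancel]
    _ ≤ 𝓖.besovLinftyNorm s p q (u n) + 𝓖.besovLinftyNorm s p q (-(u n - f)) :=
        h𝓖.besovLinftyNorm_add_le hs hp hq _ _
    _ = 𝓖.besovLinftyNorm s p q (u n) + ‖(-1 : ℂ)‖ₑ * 𝓖.besovLinftyNorm s p q (u n - f) := by
        rw [← neg_one_smul ℂ, h𝓖.besovLinftyNorm_smul hs hp hq]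
    _ < ∞ := ENNReal.add_lt_top.2 ⟨mem_besovLinfty_iff.1 (hu n),
        ENNReal.mul_lt_top enorm_lt_top hn⟩

theorem isQuasiBanachAlgebra_besovLinfty (h𝓖 : 𝓖.IsGood c₁ c₂) (hs : 0 < s) (hp : 1 ≤ p)
    (hq : 1 ≤ q) : IsQuasiBanachAlgebra (𝓖.besovLinfty s p q) (𝓖.besovLinftyNorm s p q) where
  zero_mem := mem_besovLinfty_iff.2 <| by
    rw [h𝓖.besovLinftyNorm_zero hs hp hq]
    exact ENNReal.zero_lt_top
  add_mem f hf g hg := mem_besovLinfty_iff.2 <| (h𝓖.besovLinftyNorm_add_le hs hp hq f g).trans_lt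
    (ENNReal.add_lt_top.2 ⟨mem_besovLinfty_iff.1 hf, mem_besovLinfty_iff.1 hg⟩)
  smul_mem z f hf := mem_besovLinfty_iff.2 <| by
    rw [h𝓖.besovLinftyNorm_smul hs hp hq]
    exact ENNReal.mul_lt_top enorm_lt_top (mem_besovLinfty_iff.1 hf)
  mul_mem _ hf _ hg := h𝓖.mul_mem_besovLinfty hs hp hq hf hg
  lt_top _ hf := mem_besovLinfty_iff.1 hf
  eq_zero_iff f _ := by
    refine ⟨fun h => ?_, fun h => by rw [h, h𝓖.besovLinftyNorm_zero hs hp hq]⟩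
    have hf : f =ᵐ[m] 0 :=
      (eLpNorm_eq_zero_iff f.aestronglyMeasurable ENNReal.top_ne_zero).1 (add_eq_zero.1 h).2
    exact AEEqFun.ext (hf.trans AEEqFun.coeFn_zero.symm)
  smul_eq z f _ := h𝓖.besovLinftyNorm_smul hs hp hq z f
  add_le f _ g _ := h𝓖.besovLinftyNorm_add_le hs hp hq f g
  mul_le := ⟨(gridConst c₁ c₂ s).toNNReal, fun f hf g hg => by
    rw [ENNReal.coe_toNNReal (h𝓖.gridConst_lt_top hs).ne]
    exact h𝓖.besovLinftyNorm_mul_le hs hp hq hf.2 hg.2⟩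
  complete _ hu hcauchy := h𝓖.exists_tendsto_besovLinftyNorm_sub hs hp hq hu hcauchy

end Grid.IsGood

end Completeness

section Constants

variable {I : Type*} [mI : MeasurableSpace I] {m : Measure I} {𝓖 : Grid m} {c₁ c₂ s p : ℝ}
  {q : ℝ≥0∞}

theorem ennreal_pow_rpow_comm (x : ℝ≥0∞) (k : ℕ) (y : ℝ) : (x ^ k) ^ y = (x ^ y) ^ k := by
  rw [← ENNReal.rpow_natCast_mul, mul_comm, ENNReal.rpow_mul_natCast]

theorem conjExponent_toReal_pos (hq : 1 < q) : 0 < (ENNReal.conjExponent q).toReal := by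
  refine ENNReal.toReal_pos ?_ ?_
  · simp [ENNReal.conjExponent]
  · simpa [ENNReal.conjExponent, tsub_eq_zero_iff_le] using hq

theorem holderConst_lt_top_of_le_geometric (hq : 1 ≤ q) {t : ℝ} {b : ℕ → ℝ≥0∞} {r M : ℝ≥0∞}
    (hr : r < 1) (hM : M < ∞) (hb : ∀ k, b k ^ (1 / t) ≤ r ^ k * M) : holderConst t q b < ∞ := by
  rw [holderConst]
  split_ifs with h
  · exact (iSup_le fun k => (hb k).trans (mul_le_of_le_one_left' (pow_le_one' hr.le k))).trans_lt hM
  have hq' := conjExponent_toReal_pos (hq.lt_of_ne' h)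
  set q' := (ENNReal.conjExponent q).toReal
  refine ENNReal.rpow_lt_top_of_nonneg (by positivity) (ne_of_lt ?_)
  calc ∑' k, b k ^ (q' / t) ≤ ∑' k, (r ^ q') ^ k * M ^ q' := by
        refine ENNReal.tsum_le_tsum fun k => ?_
        calc b k ^ (q' / t) = (b k ^ (1 / t)) ^ q' := by rw [← ENNReal.rpow_mul, one_div_mul_eq_div]
          _ ≤ (r ^ k * M) ^ q' := by gcongr; exact hb k
          _ = (r ^ q') ^ k * M ^ q' := by
            rw [ENNReal.mul_rpow_of_nonneg _ _ hq'.le, ennreal_pow_rpow_comm]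
    _ = (1 - r ^ q')⁻¹ * M ^ q' := by rw [ENNReal.tsum_mul_right, ENNReal.tsum_geometric]
    _ < ∞ := ENNReal.mul_lt_top (by simpa using ENNReal.rpow_lt_one hr hq')
        (ENNReal.rpow_lt_top_of_nonneg hq'.le hM.ne)

theorem one_le_haarConst (h₁ : 0 ≤ c₁) (h₂ : 0 ≤ c₂) : 1 ≤ haarConst c₁ c₂ :=
  le_add_of_nonneg_left (by positivity)

theorem one_add_rpow_neg_mul_rpow_le_stdConst (h₁ : 0 < c₁) (h₁_le : c₁ ≤ 1) (h₂ : 0 ≤ c₂)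
    (h₂_le : c₂ ≤ 1) (hs : 0 ≤ s) (p : ℝ) : 1 + c₁ ^ (-s) * c₂ ^ s ≤ stdConst c₁ c₂ s p := by
  have hH : 1 ≤ haarConst c₁ c₂ := one_le_haarConst h₁.le h₂
  refine add_le_add_right ?_ 1
  calc c₁ ^ (-s) * c₂ ^ s ≤ c₁ ^ (-s) :=
        mul_le_of_le_one_right (by positivity) (Real.rpow_le_one h₂ h₂_le hs)
    _ ≤ c₁ ^ (-2 - s) := Real.rpow_le_rpow_of_exponent_ge h₁ h₁_le (by linarith)
    _ = 1 * c₁ ^ (1 / p - s) * c₁ ^ (-2 - 1 / p) := by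
        rw [one_mul, ← Real.rpow_add h₁]
        ring_nf
    _ ≤ haarConst c₁ c₂ * max (c₂ ^ (1 / p - s)) (c₁ ^ (1 / p - s)) * c₁ ^ (-2 - 1 / p) := by
        gcongr
        exact le_max_right _ _

namespace Grid.IsGood

theorem gridConst_le (h𝓖 : 𝓖.IsGood c₁ c₂) (hs : 0 < s) :
    gridConst c₁ c₂ s ≤ ENNReal.ofReal (stdConst c₁ c₂ s p) * 𝓖.oscConst c₂ s p q := by
  have hc₁ := h𝓖.pos
  have hc₂ : 0 < c₂ := hc₁.trans h𝓖.lt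
  have hr : c₂ ^ s < 1 := Real.rpow_lt_one hc₂.le h𝓖.lt_one hs
  calc gridConst c₁ c₂ s
      = ENNReal.ofReal (1 + c₁ ^ (-s) * c₂ ^ s) * ENNReal.ofReal (1 / (1 - c₂ ^ s)) := by
        rw [ENNReal.ofReal_add zero_le_one (by positivity), ENNReal.ofReal_mul (by positivity),
          one_div, ENNReal.ofReal_inv_of_pos (sub_pos.2 hr), ENNReal.ofReal_sub _ (by positivity),
          ENNReal.ofReal_one]
        rfl
    _ ≤ ENNReal.ofReal (stdConst c₁ c₂ s p) * 𝓖.oscConst c₂ s p q := by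
        gcongr
        · exact one_add_rpow_neg_mul_rpow_le_stdConst hc₁ (h𝓖.lt.trans h𝓖.lt_one).le hc₂.le
            h𝓖.lt_one.le hs.le p
        · exact le_add_self

variable [IsFiniteMeasure m]

theorem mesh_succ_le (h𝓖 : 𝓖.IsGood c₁ c₂) (k : ℕ) :
    𝓖.mesh (k + 1) ≤ ENNReal.ofReal c₂ * 𝓖.mesh k := by
  refine iSup₂_le fun Q hQ => ?_
  obtain ⟨P, hP, hQP⟩ := h𝓖.nested k Q hQ
  have hle : m.real Q ≤ c₂ * m.real P :=
    (div_le_iff₀ (measureReal_pos hP)).1 (h𝓖.ratio k Q hQ P hP hQP).2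
  calc m Q = ENNReal.ofReal (m.real Q) := by rw [ofReal_measureReal]
    _ ≤ ENNReal.ofReal (c₂ * m.real P) := ENNReal.ofReal_le_ofReal hle
    _ = ENNReal.ofReal c₂ * m P := by
        rw [ENNReal.ofReal_mul (h𝓖.pos.trans h𝓖.lt).le, ofReal_measureReal]
    _ ≤ ENNReal.ofReal c₂ * 𝓖.mesh k := by
        gcongr
        exact le_iSup₂_of_le P hP le_rfl

theorem mesh_le (h𝓖 : 𝓖.IsGood c₁ c₂) (k : ℕ) :
    𝓖.mesh k ≤ ENNReal.ofReal c₂ ^ k * m Set.univ := by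
  induction k with
  | zero => simp [mesh, h𝓖.level_zero]
  | succ k ih =>
    rw [pow_succ', mul_assoc]
    exact (h𝓖.mesh_succ_le k).trans (by gcongr)

theorem holderConst_mesh_lt_top (h𝓖 : 𝓖.IsGood c₁ c₂) (hs : 0 < s) (hp : p ≠ 0) (hq : 1 ≤ q) :
    holderConst p q (fun k => 𝓖.mesh k ^ (s * p)) < ∞ := by
  have hr : ENNReal.ofReal c₂ ^ s < 1 :=
    ENNReal.rpow_lt_one (ENNReal.ofReal_lt_one.2 h𝓖.lt_one) hs
  refine holderConst_lt_top_of_le_geometric hq hr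
    (ENNReal.rpow_lt_top_of_nonneg hs.le (measure_ne_top m Set.univ)) fun k => ?_
  calc (𝓖.mesh k ^ (s * p)) ^ (1 / p) = 𝓖.mesh k ^ s := by
        rw [← ENNReal.rpow_mul, mul_assoc, mul_one_div_cancel hp, mul_one]
    _ ≤ (ENNReal.ofReal c₂ ^ k * m Set.univ) ^ s := by gcongr; exact h𝓖.mesh_le k
    _ = (ENNReal.ofReal c₂ ^ s) ^ k * m Set.univ ^ s := by
        rw [ENNReal.mul_rpow_of_nonneg _ _ hs.le, ennreal_pow_rpow_comm]

theorem oscConst_lt_top (h𝓖 : 𝓖.IsGood c₁ c₂) (hs : 0 < s) (hp : 0 < p) (hq : 1 ≤ q) :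
    𝓖.oscConst c₂ s p q < ∞ := by
  have hI : m Set.univ ≠ 0 := (𝓖.measure_pos 0 Set.univ (by simp [h𝓖.level_zero])).ne'
  refine ENNReal.add_lt_top.2 ⟨ENNReal.mul_lt_top (ENNReal.mul_lt_top ?_
    (h𝓖.holderConst_mesh_lt_top hs hp.ne' hq)) ?_, ENNReal.ofReal_lt_top⟩
  · exact ENNReal.rpow_lt_top_of_nonneg (by positivity) 𝓖.overlap_lt_top.ne
  · exact (ENNReal.rpow_ne_top_of_ne_zero hI (measure_ne_top m _)).lt_top

end Grid.IsGood

end Constants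

end GridBesov

theorem proposition17p1_general {I : Type*} [MeasurableSpace I] (m : Measure I) [IsFiniteMeasure m]
    (𝓖 : GridBesov.Grid m) (c₁ c₂ : ℝ) (h𝓖 : 𝓖.IsGood c₁ c₂)
    (s p : ℝ) (q : ℝ≥0∞) (hs : 0 < s) (hp : 1 ≤ p) (hq : 1 ≤ q) :
    ENNReal.ofReal (GridBesov.stdConst c₁ c₂ s p) * 𝓖.oscConst c₂ s p q < ∞ ∧
    (∀ f ∈ 𝓖.besovLinfty s p q, ∀ g ∈ 𝓖.besovLinfty s p q,
      f * g ∈ 𝓖.besovLinfty s p q ∧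
      𝓖.besovNorm s p q (f * g) + eLpNorm (f * g : I →ₘ[m] ℂ) ∞ m ≤
        ENNReal.ofReal (GridBesov.stdConst c₁ c₂ s p) * 𝓖.oscConst c₂ s p q *
          (𝓖.besovNorm s p q f + eLpNorm f ∞ m) * (𝓖.besovNorm s p q g + eLpNorm g ∞ m)) ∧
    GridBesov.IsQuasiBanachAlgebra (𝓖.besovLinfty s p q) (𝓖.besovLinftyNorm s p q) := by
  refine ⟨?_, fun f hf g hg => ⟨h𝓖.mul_mem_besovLinfty hs hp hq hf hg, ?_⟩,
    h𝓖.isQuasiBanachAlgebra_besovLinfty hs hp hq⟩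
  · exact ENNReal.mul_lt_top ENNReal.ofReal_lt_top (h𝓖.oscConst_lt_top hs (one_pos.trans_le hp) hq)
  · refine (h𝓖.besovLinftyNorm_mul_le hs hp hq hf.2 hg.2).trans ?_
    exact mul_le_mul_left (mul_le_mul_left (h𝓖.gridConst_le hs) _) _

theorem proposition17p1 {I : Type*} [MeasurableSpace I] (m : Measure I) [IsFiniteMeasure m]
    (𝓖 : GridBesov.Grid m) (c₁ c₂ : ℝ) (h𝓖 : 𝓖.IsGood c₁ c₂)
    (s p : ℝ) (q : ℝ≥0∞) (hs : 0 < s) (hsp : s < 1 / p) (hp : 1 ≤ p) (hq : 1 ≤ q) :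
    ENNReal.ofReal (GridBesov.stdConst c₁ c₂ s p) * 𝓖.oscConst c₂ s p q < ∞ ∧
    (∀ f ∈ 𝓖.besovLinfty s p q, ∀ g ∈ 𝓖.besovLinfty s p q,
      f * g ∈ 𝓖.besovLinfty s p q ∧
      𝓖.besovNorm s p q (f * g) + eLpNorm (f * g : I →ₘ[m] ℂ) ∞ m ≤
        ENNReal.ofReal (GridBesov.stdConst c₁ c₂ s p) * 𝓖.oscConst c₂ s p q *
          (𝓖.besovNorm s p q f + eLpNorm f ∞ m) * (𝓖.besovNorm s p q g + eLpNorm g ∞ m)) ∧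
    GridBesov.IsQuasiBanachAlgebra (𝓖.besovLinfty s p q) (𝓖.besovLinftyNorm s p q) :=
  proposition17p1_general m 𝓖 c₁ c₂ h𝓖 s p q hs hp hq
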